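/- For $n=0,1,2,\ldots$ let $V_n=\sum_{k=0}^n\binom{2k}{k}^2\binom{2n-2k}{n-k}^2$, and let $B_0,B_1,B_2,\ldots$ be the Bernoulli numbers, given by $B_0=1$ and $\sum_{k=0}^{n-1}\binom nk B_k=0$ for $n\ge 2$. For a prime $p$ let $\mathbb Z_p$ denote the ring of rational numbers whose denominator (in lowest terms) is not divisible by $p$; for rational numbers $a,b$ we write $a\equiv b\pmod{p^4}$ if $a-b\in p^4\mathbb Z_p$. Then for every odd prime $p$, $$\sum_{n=1}^{p-1}\frac{V_n}{16^n}\equiv\frac72\,p^3B_{p-3}\pmod{p^4}.$$ -/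

import Mathlib

/-- The numbers `V_n = ∑_{k=0}^n C(2k,k)^2 C(2n-2k,n-k)^2`. -/
def aperyV (n : ℕ) : ℕ :=
  ∑ k ∈ Finset.range (n + 1),
    (Nat.choose (2 * k) k) ^ 2 * (Nat.choose (2 * (n - k)) (n - k)) ^ 2

/-- For rational numbers `a`, `b`: `a ≡ b (mod p ^ m)` in the ring of rational numbers whose
denominator (in lowest terms) is not divisible by `p`, i.e. `a - b` is `p ^ m` times an
element of that ring. -/
def RatModEq (p m : ℕ) (a b : ℚ) : Prop :=
  ∃ r : ℚ, ¬ p ∣ r.den ∧ a - b = (p : ℚ) ^ m * r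

/-!
Write `m = (p - 1) / 2`, `a_k = (C(2k,k) / 4^k)^2` and `u_n = V_n / 16^n = ∑ a_k a_{n-k}`.

**From a convolution to a single sum.** The generating function of `a_k` satisfies a second order
differential equation, so its square satisfies the symmetric square of that equation, which is a
three-term recurrence for `u_n`. Creative telescoping shows that
`∑_k (-1)^k C(n,k) C(n+k,k) a_k` satisfies the same recurrence (`normV_eq_sum_legCoeff`).
Summation over `n` then gives (`sum_normV`)
`∑_{n<p} u_n = p ∑_{k<p} a_k / (2k+1) ∏_{i≤k} (1 - p²/i²)`.

**The terms `k ≤ m`.** Here `a_k = β_k ∏_{j≤k} (1 - p²/(2j-1)²)⁻¹` with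
`β_k = (-1)^k C(m,k) C(m+k,k)`, so modulo `p⁴` only the sums of `β_k / (2k+1)` with weights `1`,
`H_k = ∑_{i≤k} 1/i²` and `O_k = ∑_{i≤k} 1/(2i-1)²` occur (`lower_half`). The first two have closed
forms (`sum_legCoeff_div_odd`, `sum_legCoeff_harm_div_odd`); the first one contributes exactly `1`,
which is the term `n = 0` of the sum over `n`. In the third, the term `k = m` is evaluated
directly, and for `k < m` the symmetry of `β_k ≡ C(m,k)²` under `k ↦ m - k` modulo `p` gives
a sum with weights `H_k / k`, again with a closed form (`sum_legCoeff_oddHarm_zmod`).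

**The terms `k > m`.** They are `p³` times `(1/8) ∑_{k≤m} 1/(k³ a_k)` modulo `p⁴` (`upper_half`).
The polynomial `y ↦ ∑_k 1/(k³ a_k) ∏_{i<k} (1 - y²/i²)` takes the value
`4/n² ∑_{i≤n} 1/(2i-1)` at `y = n` for `1 ≤ n ≤ m`, is even, and has the wanted value at
`y = 0`; its degree is below `p - 1`, so its values on `ℤ/p` add up to zero
(`sum_inv_cube_mul_binomSq_zmod`). The double sum that appears is the one obtained by reflecting the sum of `β_k H_k / (2k+1)` over `k < m`
(`sum_legCoeff_harm_zmod`), which is already known.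

**Reduction to one quantity.** Reflection `i ↦ p - i` and splitting by parity express all harmonic
sums through `H = ∑_{i≤m} 1/i³` (`harm_two_expansion`). The total is `-(7/4) p³ H`, and
`H ≡ -2 B_{p-3}` follows from `∑_{k<p} k^{p-3} ≡ p B_{p-3}` modulo `p²`
(`reduces_bernoulli_sub_three`).

Residues modulo `p` are handled by the relation `Reduces p q x`, so that the closed forms, which
hold in every field where the relevant denominators do not vanish, can be used over `ℚ` and over
`ℤ/p` alike.
-/

open Finset

/-! ### Hypergeometric products -/

/-- The squared normalised central binomial coefficient
`(C(2k,k)/4^k)^2`, written as a product so that it makes sense in every field. -/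
def binomSq (K : Type*) [Field K] (k : ℕ) : K :=
  ∏ i ∈ range k, ((2 * i + 1 : K) / (2 * i + 2)) ^ 2

/-- The coefficient `(-x)_k (x+1)_k / k!^2` of `t^k` in the shifted Legendre function
`P_x(1-2t)`; for a natural number `x = n` it is `(-1)^k C(n,k) C(n+k,k)`. -/
def legCoeff {K : Type*} [Field K] (x : K) (k : ℕ) : K :=
  ∏ i ∈ range k, ((i : K) - x) * (i + 1 + x) / (i + 1) ^ 2

/-- The coefficient `(-y)_k (y)_k / k!^2`. -/
def epsCoeff {K : Type*} [Field K] (y : K) (k : ℕ) : K :=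
  ∏ i ∈ range k, ((i : K) ^ 2 - y ^ 2) / (i + 1) ^ 2

/-- The product `∏_{i=1}^k (1 - y^2/i^2)`. -/
def sineProd {K : Type*} [Field K] (y : K) (k : ℕ) : K :=
  ∏ i ∈ range k, (1 - y ^ 2 / (i + 1) ^ 2)

/-- The generalised harmonic number `∑_{i=1}^k 1/i^s`. -/
def harm (K : Type*) [Field K] (s k : ℕ) : K := ∑ i ∈ range k, 1 / ((i : K) + 1) ^ s

/-- The odd harmonic number `∑_{i=1}^k 1/(2i-1)^s`. -/
def oddHarm (K : Type*) [Field K] (s k : ℕ) : K := ∑ i ∈ range k, 1 / (2 * (i : K) + 1) ^ s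

section Identities

variable {K : Type*} [Field K]

lemma legCoeff_succ (x : K) (k : ℕ) :
    legCoeff x (k + 1) = legCoeff x k * (((k : K) - x) * (k + 1 + x) / (k + 1) ^ 2) :=
  prod_range_succ _ _

lemma epsCoeff_succ (y : K) (k : ℕ) :
    epsCoeff y (k + 1) = epsCoeff y k * (((k : K) ^ 2 - y ^ 2) / (k + 1) ^ 2) :=
  prod_range_succ _ _

lemma sineProd_succ (y : K) (k : ℕ) :
    sineProd y (k + 1) = sineProd y k * (1 - y ^ 2 / (k + 1) ^ 2) :=
  prod_range_succ _ _

lemma binomSq_succ (k : ℕ) :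
    binomSq K (k + 1) = binomSq K k * ((2 * k + 1 : K) / (2 * k + 2)) ^ 2 :=
  prod_range_succ _ _

lemma harm_succ (s k : ℕ) : harm K s (k + 1) = harm K s k + 1 / ((k : K) + 1) ^ s :=
  sum_range_succ _ _

lemma oddHarm_succ (s k : ℕ) :
    oddHarm K s (k + 1) = oddHarm K s k + 1 / (2 * (k : K) + 1) ^ s :=
  sum_range_succ _ _

lemma legCoeff_eq_zero {n k : ℕ} (h : n < k) : legCoeff (n : K) k = 0 :=
  prod_eq_zero (mem_range.2 h) (by simp)

/-- The natural numbers `1, …, N` are invertible in `K`. The identities below are used both over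
`ℚ` and over `ℤ/p`, and this is what they need. -/
def InvertibleUpTo (K : Type*) [Field K] (N : ℕ) : Prop :=
  ∀ i : ℕ, 0 < i → i ≤ N → (i : K) ≠ 0

lemma InvertibleUpTo.mono {M N : ℕ} (h : InvertibleUpTo K N) (hMN : M ≤ N) :
    InvertibleUpTo K M := fun i hi hi' => h i hi (hi'.trans hMN)

lemma InvertibleUpTo.succ_ne {N k : ℕ} (h : InvertibleUpTo K N) (hk : k < N) :
    (k : K) + 1 ≠ 0 := by
  exact_mod_cast h (k + 1) k.succ_pos hk

lemma InvertibleUpTo.two_mul_succ_ne {N k : ℕ} (h : InvertibleUpTo K N) (hk : 2 * k < N) :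
    2 * (k : K) + 1 ≠ 0 := by
  exact_mod_cast h (2 * k + 1) (by omega) hk

lemma invertibleUpTo_of_charZero [CharZero K] (N : ℕ) : InvertibleUpTo K N :=
  fun i hi _ => by exact_mod_cast hi.ne'

lemma mul_sineProd {N : ℕ} (hK : InvertibleUpTo K N) (y : K) {k : ℕ} (hk : k ≤ N) :
    y * sineProd y k = (y - k) * legCoeff y k := by
  induction k with
  | zero => simp [sineProd, legCoeff]
  | succ k ih =>
    have h1 := hK.succ_ne hk
    rw [sineProd_succ, legCoeff_succ, ← mul_assoc, ih (by omega)]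
    push_cast
    field_simp
    ring

lemma add_one_mul_sineProd {N : ℕ} (hK : InvertibleUpTo K N) (y : K) {k : ℕ} (hk : k ≤ N) :
    (y + 1) * sineProd (y + 1) k = (y + 1 + k) * legCoeff y k := by
  induction k with
  | zero => simp [sineProd, legCoeff]
  | succ k ih =>
    have h1 := hK.succ_ne hk
    rw [sineProd_succ, legCoeff_succ, ← mul_assoc, ih (by omega)]
    push_cast
    field_simp
    ring

lemma mul_legCoeff {N : ℕ} (hK : InvertibleUpTo K N) (y : K) {k : ℕ} (hk : k ≤ N) :
    y * legCoeff y k = (y + k) * epsCoeff y k := by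
  induction k with
  | zero => simp [epsCoeff, legCoeff]
  | succ k ih =>
    have h1 := hK.succ_ne hk
    rw [epsCoeff_succ, legCoeff_succ, ← mul_assoc, ih (by omega)]
    push_cast
    field_simp
    ring

lemma add_one_mul_legCoeff {N : ℕ} (hK : InvertibleUpTo K N) (y : K) {k : ℕ} (hk : k ≤ N) :
    (y + 1) * legCoeff y k = (y + 1 - k) * epsCoeff (y + 1) k := by
  induction k with
  | zero => simp [epsCoeff, legCoeff]
  | succ k ih =>
    have h1 := hK.succ_ne hk
    rw [epsCoeff_succ, legCoeff_succ, ← mul_assoc, ih (by omega)]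
    push_cast
    field_simp
    ring

lemma epsCoeff_succ_eq_sineProd {N : ℕ} (hK : InvertibleUpTo K N) (y : K) {k : ℕ} (hk : k < N) :
    epsCoeff y (k + 1) = -y ^ 2 / (k + 1) ^ 2 * sineProd y k := by
  induction k with
  | zero => simp [epsCoeff, sineProd]
  | succ k ih =>
    have h1 := hK.succ_ne hk
    have h2 := hK.succ_ne (show k < N by omega)
    rw [epsCoeff_succ, ih (by omega), sineProd_succ]
    push_cast at h1 ⊢
    field_simp

lemma sum_epsCoeff {N : ℕ} (hK : InvertibleUpTo K N) (y : K) {k : ℕ} (hk : k ≤ N) :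
    ∑ i ∈ range (k + 1), epsCoeff y i = sineProd y k := by
  induction k with
  | zero => simp [sineProd, epsCoeff]
  | succ k ih =>
    have h1 := hK.succ_ne hk
    rw [sum_range_succ, ih (by omega), epsCoeff_succ_eq_sineProd hK y hk, sineProd_succ]
    field_simp
    ring

/-! ### Sums of Legendre coefficients with harmonic weights -/

lemma sineProd_eq_zero {n k : ℕ} (h0 : 0 < n) (h : n ≤ k) (hn : (n : K) ≠ 0) :
    sineProd (n : K) k = 0 := by
  refine prod_eq_zero (mem_range.2 (show n - 1 < k by omega)) ?_
  have : ((n - 1 : ℕ) : K) + 1 = n := by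
    rw [← Nat.cast_succ, Nat.succ_eq_add_one, Nat.sub_add_cancel h0]
  rw [this, div_self (pow_ne_zero _ hn), sub_self]

/-- Summation by parts against `epsCoeff`, whose partial sums are the products `sineProd`. -/
lemma sum_epsCoeff_mul_sum {n : ℕ} (hK : InvertibleUpTo K n) (hn : 0 < n) (y : ℕ → K) :
    ∑ k ∈ range (n + 1), epsCoeff (n : K) k * ∑ j ∈ range k, y j =
      -∑ j ∈ range n, y j * sineProd (n : K) j := by
  have key : ∀ l ≤ n, ∑ k ∈ range (l + 1), epsCoeff (n : K) k * ∑ j ∈ range k, y j =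
      sineProd (n : K) l * ∑ j ∈ range l, y j - ∑ j ∈ range l, y j * sineProd (n : K) j := by
    intro l
    induction l with
    | zero => simp
    | succ l ih =>
      intro hl
      have h1 := sum_epsCoeff hK (n : K) (show l ≤ n by omega)
      have h2 := sum_epsCoeff hK (n : K) hl
      rw [sum_range_succ, h1] at h2
      rw [sum_range_succ, ih (by omega), sum_range_succ _ l, sum_range_succ _ l, ← h2]
      ring
  rw [key n le_rfl, sineProd_eq_zero hn le_rfl (hK n hn le_rfl)]
  ring

lemma sum_epsCoeff_eq_zero {n : ℕ} (hK : InvertibleUpTo K n) (hn : 0 < n) :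
    ∑ k ∈ range (n + 1), epsCoeff (n : K) k = 0 := by
  rw [sum_epsCoeff hK _ le_rfl, sineProd_eq_zero hn le_rfl (hK n hn le_rfl)]

/-- The recursion in `n` for sums `∑ (-1)^k C(n,k) C(n+k,k) Y_k / (2k+1)`. -/
lemma legCoeff_div_odd_rec {n : ℕ} (hK : InvertibleUpTo K (2 * n + 3)) (Y : ℕ → K) :
    (2 * (n : K) + 3) * ∑ k ∈ range (n + 2), legCoeff ((n : K) + 1) k * Y k / (2 * k + 1) =
      (2 * (n : K) + 1) * ∑ k ∈ range (n + 1), legCoeff (n : K) k * Y k / (2 * k + 1) +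
      2 * ∑ k ∈ range (n + 2), epsCoeff ((n : K) + 1) k * Y k := by
  have hext : ∑ k ∈ range (n + 1), legCoeff (n : K) k * Y k / (2 * k + 1) =
      ∑ k ∈ range (n + 2), legCoeff (n : K) k * Y k / (2 * k + 1) := by
    rw [sum_range_succ _ (n + 1), legCoeff_eq_zero (by omega)]
    simp
  rw [hext, mul_sum, mul_sum, mul_sum, ← sum_add_distrib]
  refine sum_congr rfl fun k hk => ?_
  have hk := mem_range.1 hk
  have h1 := hK.two_mul_succ_ne (show 2 * k < 2 * n + 3 by omega)
  have h2 := hK.succ_ne (show n < 2 * n + 3 by omega)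
  have e1 := mul_legCoeff hK ((n : K) + 1) (show k ≤ 2 * n + 3 by omega)
  have e2 := add_one_mul_legCoeff hK (n : K) (show k ≤ 2 * n + 3 by omega)
  field_simp
  apply mul_left_cancel₀ h2
  linear_combination ((2 * n + 3 : K) * e1 - (2 * n + 1 : K) * e2) * Y k

/-- The recursion in `n` for sums `∑_{k ≥ 1} (-1)^k C(n,k) C(n+k,k) Y_k / k`. -/
lemma legCoeff_div_rec {n : ℕ} (hK : InvertibleUpTo K (n + 1)) (Y : ℕ → K) (hY : Y 0 = 0) :
    ((n : K) + 1) * ∑ k ∈ range (n + 1), legCoeff ((n : K) + 1) (k + 1) * Y (k + 1) / (k + 1) =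
      ((n : K) + 1) * ∑ k ∈ range n, legCoeff (n : K) (k + 1) * Y (k + 1) / (k + 1) +
      2 * ∑ k ∈ range (n + 2), epsCoeff ((n : K) + 1) k * Y k := by
  have hext : ∑ k ∈ range n, legCoeff (n : K) (k + 1) * Y (k + 1) / (k + 1) =
      ∑ k ∈ range (n + 1), legCoeff (n : K) (k + 1) * Y (k + 1) / (k + 1) := by
    rw [sum_range_succ _ n, legCoeff_eq_zero (by omega)]
    simp
  rw [hext, sum_range_succ' _ (n + 1), hY, mul_zero, add_zero, mul_sum, mul_sum, mul_sum,
    ← sum_add_distrib]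
  refine sum_congr rfl fun k hk => ?_
  have hk := mem_range.1 hk
  have h1 := hK.succ_ne hk
  have e1 := mul_legCoeff hK ((n : K) + 1) (show k + 1 ≤ n + 1 by omega)
  have e2 := add_one_mul_legCoeff hK (n : K) (show k + 1 ≤ n + 1 by omega)
  push_cast at e1 e2 ⊢
  field_simp
  linear_combination (e1 - e2) * Y (k + 1)

lemma sum_legCoeff_div_odd {n : ℕ} (hK : InvertibleUpTo K (2 * n + 1)) :
    (2 * (n : K) + 1) * ∑ k ∈ range (n + 1), legCoeff (n : K) k / (2 * k + 1) = 1 := by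
  induction n with
  | zero => simp [legCoeff]
  | succ n ih =>
    have h := legCoeff_div_odd_rec hK (fun _ => 1)
    have h0 := sum_epsCoeff_eq_zero (hK.mono (show n + 1 ≤ _ by omega)) n.succ_pos
    simp only [mul_one] at h
    push_cast at h0 ⊢
    rw [h0, ih (hK.mono (by omega))] at h
    linear_combination h

lemma sum_epsCoeff_mul_harm {n : ℕ} (hK : InvertibleUpTo K n) (hn : 0 < n) :
    (n : K) ^ 2 * ∑ k ∈ range (n + 1), epsCoeff (n : K) k * harm K 2 k = -1 := by
  have h0 := sum_epsCoeff_eq_zero hK hn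
  rw [sum_range_succ'] at h0
  have h1 : epsCoeff (n : K) 0 = 1 := by simp [epsCoeff]
  unfold harm
  rw [sum_epsCoeff_mul_sum hK hn, ← sum_neg_distrib, mul_sum]
  have : ∑ i ∈ range n, (n : K) ^ 2 * -(1 / ((i : K) + 1) ^ 2 * sineProd (n : K) i) =
      ∑ i ∈ range n, epsCoeff (n : K) (i + 1) := by
    refine sum_congr rfl fun i hi => ?_
    rw [epsCoeff_succ_eq_sineProd hK _ (mem_range.1 hi)]
    ring
  rw [this]
  linear_combination h0 - h1

lemma sum_legCoeff_harm_div_odd {n : ℕ} (hK : InvertibleUpTo K (2 * n + 1)) :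
    (2 * (n : K) + 1) * ∑ k ∈ range (n + 1), legCoeff (n : K) k * harm K 2 k / (2 * k + 1) =
      -2 * harm K 2 n := by
  induction n with
  | zero => simp [harm]
  | succ n ih =>
    have h := legCoeff_div_odd_rec hK (harm K 2)
    have h0 := sum_epsCoeff_mul_harm (hK.mono (show n + 1 ≤ _ by omega)) n.succ_pos
    have h1 := hK.succ_ne (show n < 2 * (n + 1) + 1 by omega)
    push_cast at h0 ⊢
    rw [ih (hK.mono (by omega))] at h
    rw [harm_succ]
    have h2 : ∑ k ∈ range (n + 1 + 1), epsCoeff ((n : K) + 1) k * harm K 2 k =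
      -1 / ((n : K) + 1) ^ 2 := by field_simp; linear_combination h0
    rw [h2] at h
    linear_combination h

lemma sum_legCoeff_harm_div {n : ℕ} (hK : InvertibleUpTo K n) :
    ∑ k ∈ range n, legCoeff (n : K) (k + 1) * harm K 2 (k + 1) / (k + 1) = -2 * harm K 3 n := by
  induction n with
  | zero => simp [harm]
  | succ n ih =>
    have h := legCoeff_div_rec hK (harm K 2) (by simp [harm])
    have h0 := sum_epsCoeff_mul_harm hK n.succ_pos
    have h1 := hK.succ_ne n.lt_succ_self
    push_cast at h0 ⊢
    rw [ih (hK.mono (by omega))] at h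
    rw [harm_succ]
    have h2 : ∑ k ∈ range (n + 1 + 1), epsCoeff ((n : K) + 1) k * harm K 2 k =
      -1 / ((n : K) + 1) ^ 2 := by field_simp; linear_combination h0
    rw [h2] at h
    apply mul_left_cancel₀ h1
    rw [h]
    field_simp
    ring

/-- The increment in `n` is the sum evaluated in `sum_legCoeff_div_odd`. -/
lemma sum_sineProd_div_odd_sq {n : ℕ} (hK : InvertibleUpTo K (2 * n)) :
    (n : K) * ∑ k ∈ range n, sineProd (n : K) k / (2 * k + 1) ^ 2 = oddHarm K 1 n := by
  induction n with
  | zero => simp [oddHarm]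
  | succ n ih =>
    have h0 := sum_legCoeff_div_odd (hK.mono (show 2 * n + 1 ≤ _ by omega))
    have hn := hK.two_mul_succ_ne (show 2 * n < 2 * (n + 1) by omega)
    have hext : (n : K) * ∑ k ∈ range n, sineProd (n : K) k / (2 * k + 1) ^ 2 =
        (n : K) * ∑ k ∈ range (n + 1), sineProd (n : K) k / (2 * k + 1) ^ 2 := by
      rcases n.eq_zero_or_pos with rfl | h
      · simp
      · rw [sum_range_succ _ n, sineProd_eq_zero h le_rfl (hK n h (by omega))]
        simp
    have key : (((n + 1 : ℕ) : K)) * ∑ k ∈ range (n + 1),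
        sineProd ((n + 1 : ℕ) : K) k / (2 * k + 1) ^ 2 =
        (n : K) * ∑ k ∈ range (n + 1), sineProd (n : K) k / (2 * k + 1) ^ 2 +
        ∑ k ∈ range (n + 1), legCoeff (n : K) k / (2 * k + 1) := by
      rw [mul_sum, mul_sum, ← sum_add_distrib]
      refine sum_congr rfl fun k hk => ?_
      have hk := mem_range.1 hk
      have h1 := hK.two_mul_succ_ne (show 2 * k < 2 * (n + 1) by omega)
      have e1 := mul_sineProd hK (n : K) (show k ≤ _ by omega)
      have e2 := add_one_mul_sineProd hK (n : K) (show k ≤ _ by omega)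
      push_cast
      field_simp
      linear_combination e2 - e1
    rw [key, ← hext, ih (hK.mono (by omega)), oddHarm_succ]
    congr 1
    field_simp
    linear_combination h0

lemma sum_legCoeff_oddHarm_div {n : ℕ} (hK : InvertibleUpTo K (2 * n)) :
    ∑ k ∈ range n, legCoeff (n : K) (k + 1) * oddHarm K 2 (k + 1) / (k + 1) =
      -2 * ∑ j ∈ range n, oddHarm K 1 (j + 1) / ((j : K) + 1) ^ 2 := by
  induction n with
  | zero => simp
  | succ n ih =>
    have h := legCoeff_div_rec (hK.mono (show n + 1 ≤ _ by omega)) (oddHarm K 2)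
      (by simp [oddHarm])
    have h0 := sum_sineProd_div_odd_sq hK
    have h1 := hK.succ_ne (show n < 2 * (n + 1) by omega)
    have h2 : ∑ k ∈ range (n + 2), epsCoeff ((n + 1 : ℕ) : K) k * oddHarm K 2 k =
        - ∑ k ∈ range (n + 1), sineProd ((n + 1 : ℕ) : K) k / (2 * k + 1) ^ 2 := by
      unfold oddHarm
      rw [sum_epsCoeff_mul_sum (hK.mono (by omega)) n.succ_pos]
      congr 1
      exact sum_congr rfl fun k _ => by ring
    push_cast at h0 h2 ⊢
    rw [h2, ih (hK.mono (by omega))] at h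
    rw [sum_range_succ (fun j : ℕ => oddHarm K 1 (j + 1) / ((j : K) + 1) ^ 2)]
    apply mul_left_cancel₀ h1
    rw [h, ← h0]
    field_simp
    ring

lemma binomSq_ne_zero {k : ℕ} (hK : InvertibleUpTo K (2 * k)) : binomSq K k ≠ 0 := by
  refine prod_ne_zero_iff.2 fun i hi => ?_
  have hi := mem_range.1 hi
  have h1 := hK.two_mul_succ_ne (show 2 * i < 2 * k by omega)
  have h2 : 2 * (i : K) + 2 ≠ 0 := by
    exact_mod_cast hK (2 * i + 2) (by omega) (by omega)
  positivity

/-- The sum telescopes: its partial sums are `1 - legCoeff n l / binomSq l`. -/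
lemma sum_legCoeff_div_odd_sq_mul_binomSq {n : ℕ} (hK : InvertibleUpTo K (2 * n + 2)) :
    (2 * (n : K) + 1) ^ 2 *
      ∑ k ∈ range (n + 1), legCoeff (n : K) k / ((2 * k + 1) ^ 2 * binomSq K k) = 1 := by
  have h2 : (2 : K) ≠ 0 := by exact_mod_cast hK 2 (by omega) (by omega)
  have hb : ∀ k ≤ n + 1, binomSq K k ≠ 0 := fun k hk => binomSq_ne_zero (hK.mono (by omega))
  have key : ∀ l ≤ n + 1, (2 * (n : K) + 1) ^ 2 *
      ∑ k ∈ range l, legCoeff (n : K) k / ((2 * k + 1) ^ 2 * binomSq K k) =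
      1 - legCoeff (n : K) l / binomSq K l := by
    intro l
    induction l with
    | zero => simp [legCoeff, binomSq]
    | succ l ih =>
      intro hl
      have h1 := hK.two_mul_succ_ne (show 2 * l < 2 * n + 2 by omega)
      have h3 := hK.succ_ne (show l < 2 * n + 2 by omega)
      have h4 : 2 * (l : K) + 2 = 2 * (l + 1) := by ring
      have hbl := hb l (by omega)
      rw [sum_range_succ, mul_add, ih (by omega), legCoeff_succ, binomSq_succ, h4]
      field_simp
      ring
  rw [key _ le_rfl, legCoeff_eq_zero (Nat.lt_succ_self n)]
  simp

/-- The increment in `n` is the sum evaluated in `sum_legCoeff_div_odd_sq_mul_binomSq`. -/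
lemma sum_sineProd_div_cube_mul_binomSq {n : ℕ} (hK : InvertibleUpTo K (2 * n)) :
    (n : K) ^ 2 * ∑ k ∈ range n, sineProd (n : K) k / ((k + 1) ^ 3 * binomSq K (k + 1)) =
      4 * oddHarm K 1 n := by
  induction n with
  | zero => simp [oddHarm]
  | succ n ih =>
    have h0 := sum_legCoeff_div_odd_sq_mul_binomSq (hK.mono (show 2 * n + 2 ≤ _ by omega))
    have hn := hK.two_mul_succ_ne (show 2 * n < 2 * (n + 1) by omega)
    have hext : (n : K) ^ 2 *
        ∑ k ∈ range n, sineProd (n : K) k / ((k + 1) ^ 3 * binomSq K (k + 1)) = (n : K) ^ 2 *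
        ∑ k ∈ range (n + 1), sineProd (n : K) k / ((k + 1) ^ 3 * binomSq K (k + 1)) := by
      rcases n.eq_zero_or_pos with rfl | h
      · simp
      · rw [sum_range_succ _ n, sineProd_eq_zero h le_rfl (hK n h (by omega))]
        simp
    have key : ((n + 1 : ℕ) : K) ^ 2 * ∑ k ∈ range (n + 1),
        sineProd ((n + 1 : ℕ) : K) k / ((k + 1) ^ 3 * binomSq K (k + 1)) =
        (n : K) ^ 2 *
          ∑ k ∈ range (n + 1), sineProd (n : K) k / ((k + 1) ^ 3 * binomSq K (k + 1)) +
        4 * (2 * n + 1) *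
          ∑ k ∈ range (n + 1), legCoeff (n : K) k / ((2 * k + 1) ^ 2 * binomSq K k) := by
      rw [mul_sum, mul_sum, mul_sum, ← sum_add_distrib]
      refine sum_congr rfl fun k hk => ?_
      have hk := mem_range.1 hk
      have h1 := hK.two_mul_succ_ne (show 2 * k < 2 * (n + 1) by omega)
      have h2 : (2 : K) ≠ 0 := by exact_mod_cast hK 2 (by omega) (by omega)
      have h3 := hK.succ_ne (show k < 2 * (n + 1) by omega)
      have h4 : 2 * (k : K) + 2 = 2 * (k + 1) := by ring
      have h5 : binomSq K k ≠ 0 := binomSq_ne_zero (hK.mono (by omega))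
      have e1 := mul_sineProd hK (n : K) (show k ≤ _ by omega)
      have e2 := add_one_mul_sineProd hK (n : K) (show k ≤ _ by omega)
      rw [binomSq_succ, h4]
      push_cast
      field_simp
      linear_combination 4 / (2 * (k : K) + 1) ^ 2 * ((n + 1 : K) * e2 - n * e1)
    rw [key, ← hext, ih (hK.mono (by omega)), oddHarm_succ, mul_add]
    field_simp
    linear_combination 4 * h0

end Identities

/-! ### The normalised numbers `V_n / 16^n` -/

section NormalisedSum

open PowerSeries

/-- The number `V_n / 16^n`, a convolution square of `(C(2k,k)/4^k)^2`. -/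
def normV (n : ℕ) : ℚ := ∑ k ∈ range (n + 1), binomSq ℚ k * binomSq ℚ (n - k)

lemma binomSq_eq_choose (k : ℕ) : binomSq ℚ k = ((2 * k).choose k : ℚ) ^ 2 / 16 ^ k := by
  induction k with
  | zero => simp [binomSq]
  | succ k ih =>
    have h := Nat.succ_mul_centralBinom_succ k
    simp only [Nat.centralBinom] at h
    have h' : ((k : ℚ) + 1) * ((2 * (k + 1)).choose (k + 1) : ℚ) =
      2 * (2 * k + 1) * ((2 * k).choose k : ℚ) := by exact_mod_cast h
    have h1 : (k : ℚ) + 1 ≠ 0 := by positivity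
    have h2 : ((2 * (k + 1)).choose (k + 1) : ℚ) =
      2 * (2 * k + 1) * ((2 * k).choose k : ℚ) / (k + 1) := by
        field_simp; linear_combination h'
    have h4 : 2 * (k : ℚ) + 2 = 2 * (k + 1) := by ring
    rw [binomSq_succ, ih, h2, h4]
    field_simp
    ring

lemma aperyV_div (n : ℕ) : (aperyV n : ℚ) / 16 ^ n = normV n := by
  unfold aperyV normV
  push_cast
  rw [sum_div]
  refine sum_congr rfl fun k hk => ?_
  have hk := mem_range.1 hk
  rw [binomSq_eq_choose, binomSq_eq_choose]
  have : (16 : ℚ) ^ n = 16 ^ k * 16 ^ (n - k) := by rw [← pow_add]; congr 1; omega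
  rw [this]
  field_simp

/-- The generating function `∑ a_k X^k` with `a_k = (C(2k,k)/4^k)^2`, that is
`₂F₁(1/2, 1/2; 1; X)`. -/
noncomputable def binomSqSeries : ℚ⟦X⟧ := PowerSeries.mk (binomSq ℚ)

lemma coeff_X_sub_X_sq_mul (f : ℚ⟦X⟧) (n : ℕ) :
    coeff (n + 2) ((X - X ^ 2) * f) = coeff (n + 1) f - coeff n f := by
  rw [sub_mul, map_sub, coeff_succ_X_mul, coeff_X_pow_mul]

lemma coeff_one_X_sub_X_sq_mul (f : ℚ⟦X⟧) : coeff 1 ((X - X ^ 2) * f) = coeff 0 f := by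
  rw [sub_mul, map_sub, show (1 : ℕ) = 0 + 1 from rfl, coeff_succ_X_mul, coeff_X_pow_mul']
  simp

/-- The hypergeometric differential equation `(A f')' = f/4`, `A = X - X^2`. -/
lemma binomSqSeries_ode :
    d⁄dX ℚ ((X - X ^ 2) * d⁄dX ℚ binomSqSeries) = C (1 / 4) * binomSqSeries := by
  ext n
  rw [coeff_derivative, coeff_C_mul]
  rcases n with _ | n
  · rw [coeff_one_X_sub_X_sq_mul, coeff_derivative]
    simp [binomSqSeries, binomSq]
    norm_num
  · rw [coeff_X_sub_X_sq_mul, coeff_derivative, coeff_derivative]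
    simp only [binomSqSeries, coeff_mk]
    rw [binomSq_succ (n + 1)]
    push_cast
    have h4 : 2 * ((n : ℚ) + 1) + 2 = 2 * (n + 2) := by ring
    have h5 : (n : ℚ) + 2 ≠ 0 := by positivity
    rw [h4]
    field_simp
    ring

lemma coeff_binomSqSeries_sq (n : ℕ) : coeff n (binomSqSeries ^ 2) = normV n := by
  rw [pow_two, coeff_mul, Nat.sum_antidiagonal_eq_sum_range_succ_mk]
  simp [binomSqSeries, normV]

/-- The symmetric square of the equation `(A f')' = f/4`: since
`A ((A w')' - w/2) = 2 (A f')^2` for `w = f^2`, one more derivative closes the system. -/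
lemma binomSqSeries_sq_ode :
    d⁄dX ℚ ((X - X ^ 2) * (d⁄dX ℚ ((X - X ^ 2) * d⁄dX ℚ (binomSqSeries ^ 2)) -
      C (1 / 2) * binomSqSeries ^ 2)) =
    C (1 / 2) * ((X - X ^ 2) * d⁄dX ℚ (binomSqSeries ^ 2)) := by
  have h := binomSqSeries_ode
  set f := binomSqSeries
  set A : ℚ⟦X⟧ := X - X ^ 2
  have hc : (C (1 / 2) : ℚ⟦X⟧) = 2 * C (1 / 4) := by
    rw [show (2 : ℚ⟦X⟧) = C 2 from (map_ofNat C 2).symm, ← map_mul]; norm_num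
  have hw : d⁄dX ℚ (f ^ 2) = 2 * f * d⁄dX ℚ f := by
    rw [pow_two, Derivation.leibniz]; simp only [smul_eq_mul]; ring
  have h1 : d⁄dX ℚ (A * d⁄dX ℚ (f ^ 2)) =
      2 * (d⁄dX ℚ f * (A * d⁄dX ℚ f) + f * (C (1 / 4) * f)) := by
    rw [hw, show A * (2 * f * d⁄dX ℚ f) = f * (A * d⁄dX ℚ f) + f * (A * d⁄dX ℚ f) by ring,
      map_add, Derivation.leibniz, h]
    simp only [smul_eq_mul]; ring
  have h2 : A * (d⁄dX ℚ (A * d⁄dX ℚ (f ^ 2)) - C (1 / 2) * f ^ 2) =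
      (A * d⁄dX ℚ f) * (A * d⁄dX ℚ f) + (A * d⁄dX ℚ f) * (A * d⁄dX ℚ f) := by
    rw [h1, hc]; ring
  rw [h2, map_add, Derivation.leibniz, h, hw, hc]
  simp only [smul_eq_mul]
  ring

lemma normV_zero : normV 0 = 1 := by simp [normV, binomSq]

lemma normV_one : normV 1 = 1 / 2 := by
  simp [normV, binomSq, sum_range_succ]; norm_num

/-- The three-term recurrence, read off from `binomSqSeries_sq_ode`. -/
lemma normV_rec (n : ℕ) :
    ((n : ℚ) + 2) ^ 3 * normV (n + 2) =
      (n + 3 / 2) * (2 * (n + 1) ^ 2 + 2 * (n + 1) + 1) * normV (n + 1) -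
        (n + 1) ^ 3 * normV n := by
  have h := congrArg (coeff (n + 1)) binomSqSeries_sq_ode
  have hD : ∀ k, coeff k (d⁄dX ℚ (binomSqSeries ^ 2)) = normV (k + 1) * (k + 1) := fun k => by
    rw [coeff_derivative, coeff_binomSqSeries_sq]
  have hA : ∀ k, coeff (k + 1) ((X - X ^ 2) * d⁄dX ℚ (binomSqSeries ^ 2)) =
      normV (k + 1) * (k + 1) - normV k * k := by
    intro k
    rcases k with _ | k
    · rw [zero_add, coeff_one_X_sub_X_sq_mul, hD]; simp
    · rw [coeff_X_sub_X_sq_mul, hD, hD]; push_cast; ring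
  rw [coeff_derivative, coeff_X_sub_X_sq_mul, coeff_C_mul, hA, map_sub, map_sub, coeff_C_mul,
    coeff_C_mul, coeff_derivative, coeff_derivative, coeff_binomSqSeries_sq,
    coeff_binomSqSeries_sq, hA, hA] at h
  push_cast at h ⊢
  linear_combination h

lemma legCoeff_add_one_succ (y : ℚ) (k : ℕ) :
    legCoeff (y + 1) (k + 1) =
      legCoeff y (k + 1) - 2 * (y + k + 1) / (k + 1) * legCoeff y k := by
  induction k with
  | zero => simp [legCoeff]; ring
  | succ k ih =>
    have h1 : (k : ℚ) + 1 ≠ 0 := by positivity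
    have h2 : (k : ℚ) + 1 + 1 ≠ 0 := by positivity
    rw [legCoeff_succ (y + 1), ih, legCoeff_succ y (k + 1), legCoeff_succ y k]
    push_cast
    field_simp
    ring

lemma legCoeff_succ_of_add_one (y : ℚ) (k : ℕ) :
    legCoeff y (k + 1) =
      legCoeff (y + 1) (k + 1) + 2 * (y + 1 - k) / (k + 1) * legCoeff (y + 1) k := by
  induction k with
  | zero => simp [legCoeff]; ring
  | succ k ih =>
    have h1 : (k : ℚ) + 1 ≠ 0 := by positivity
    have h2 : (k : ℚ) + 1 + 1 ≠ 0 := by positivity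
    rw [legCoeff_succ y, ih, legCoeff_succ (y + 1) (k + 1), legCoeff_succ (y + 1) k]
    push_cast
    field_simp
    ring

/-- The creative telescoping step: the recurrence operator of `normV` applied to the summand
`legCoeff n k * binomSq k` is a difference in `k`. -/
lemma sum_legCoeff_mul_binomSq_telescope (y : ℚ) (k : ℕ) :
    ∑ i ∈ range (k + 1), ((y + 2) ^ 3 * legCoeff (y + 2) i -
      (y + 3 / 2) * (2 * (y + 1) ^ 2 + 2 * (y + 1) + 1) * legCoeff (y + 1) i +
        (y + 1) ^ 3 * legCoeff y i) * binomSq ℚ i =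
      (2 * y + 3) * (2 * (k + 1 / 2) ^ 2 * legCoeff (y + 1) k * binomSq ℚ k) := by
  induction k with
  | zero => simp [legCoeff, binomSq]; ring
  | succ k ih =>
    have h1 : (k : ℚ) + 1 ≠ 0 := by positivity
    have h4 : 2 * (k : ℚ) + 2 = 2 * (k + 1) := by ring
    have e1 := legCoeff_add_one_succ (y + 1) k
    have e2 := legCoeff_succ_of_add_one y k
    rw [show y + 1 + 1 = y + 2 by ring] at e1
    rw [sum_range_succ, ih, e1, e2, legCoeff_succ (y + 1) k, binomSq_succ, h4]
    push_cast
    field_simp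
    ring

lemma normV_eq_sum_legCoeff (n : ℕ) :
    normV n = ∑ k ∈ range (n + 1), legCoeff (n : ℚ) k * binomSq ℚ k := by
  induction n using Nat.twoStepInduction with
  | zero => simp [normV_zero, legCoeff, binomSq]
  | one => simp [normV_one, legCoeff, binomSq, sum_range_succ]; norm_num
  | more n ih1 ih2 =>
    have h := sum_legCoeff_mul_binomSq_telescope (n : ℚ) (n + 2)
    have hz : legCoeff ((n : ℚ) + 1) (n + 2) = 0 := by
      exact_mod_cast legCoeff_eq_zero (K := ℚ) (show n + 1 < n + 2 by omega)
    have e1 : ∑ k ∈ range (n + 2), legCoeff ((n + 1 : ℕ) : ℚ) k * binomSq ℚ k =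
        ∑ k ∈ range (n + 3), legCoeff ((n : ℚ) + 1) k * binomSq ℚ k := by
      rw [sum_range_succ _ (n + 2), hz]; push_cast; ring
    have e2 : ∑ k ∈ range (n + 1), legCoeff (n : ℚ) k * binomSq ℚ k =
        ∑ k ∈ range (n + 3), legCoeff (n : ℚ) k * binomSq ℚ k := by
      rw [sum_range_succ _ (n + 2), sum_range_succ _ (n + 1), legCoeff_eq_zero (by omega),
        legCoeff_eq_zero (by omega)]
      ring
    have hr := normV_rec n
    rw [ih1, ih2, e1, e2] at hr
    rw [hz] at h
    simp only [add_mul, sub_mul, sum_add_distrib, sum_sub_distrib, mul_assoc, ← mul_sum] at h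
    have h2 : ((n : ℚ) + 2) ^ 3 ≠ 0 := by positivity
    apply mul_left_cancel₀ h2
    rw [hr]
    push_cast
    linear_combination -h

lemma sum_normV (N : ℕ) :
    ∑ n ∈ range N, normV n =
      N * ∑ k ∈ range N, binomSq ℚ k * sineProd (N : ℚ) k / (2 * k + 1) := by
  induction N with
  | zero => simp
  | succ N ih =>
    have hext : (N : ℚ) * ∑ k ∈ range N, binomSq ℚ k * sineProd (N : ℚ) k / (2 * k + 1) =
        N * ∑ k ∈ range (N + 1), binomSq ℚ k * sineProd (N : ℚ) k / (2 * k + 1) := by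
      rcases N.eq_zero_or_pos with rfl | h
      · simp
      · rw [sum_range_succ _ N, sineProd_eq_zero h le_rfl (by positivity)]
        simp
    rw [sum_range_succ, ih, hext, normV_eq_sum_legCoeff, mul_sum, mul_sum, ← sum_add_distrib]
    refine sum_congr rfl fun k hk => ?_
    have hK : InvertibleUpTo ℚ k := invertibleUpTo_of_charZero k
    have e1 := mul_sineProd hK (N : ℚ) le_rfl
    have e2 := add_one_mul_sineProd hK (N : ℚ) le_rfl
    have h1 : 2 * (k : ℚ) + 1 ≠ 0 := by positivity
    push_cast
    field_simp
    linear_combination binomSq ℚ k * (e1 - e2)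

end NormalisedSum

/-! ### The identities modulo `p = 2m + 1` -/

section ModPrime

variable {p m : ℕ} [Fact p.Prime]

lemma invertibleUpTo_zmod (hpm : 2 * m + 1 = p) : InvertibleUpTo (ZMod p) (2 * m) := by
  intro i hi hi' h
  rw [ZMod.natCast_eq_zero_iff] at h
  exact absurd (Nat.le_of_dvd hi h) (by omega)

lemma two_mul_half_add_one (hpm : 2 * m + 1 = p) : 2 * (m : ZMod p) + 1 = 0 := by
  have : ((2 * m + 1 : ℕ) : ZMod p) = 0 := by rw [hpm]; exact ZMod.natCast_self p
  exact_mod_cast this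

lemma zmod_two_ne_zero (hpm : 2 * m + 1 = p) : (2 : ZMod p) ≠ 0 := by
  have hp := (Fact.out : p.Prime).two_le
  exact_mod_cast invertibleUpTo_zmod hpm 2 (by omega) (by omega)

lemma legCoeff_half_eq_binomSq (hpm : 2 * m + 1 = p) {k : ℕ} (hk : k ≤ m) :
    legCoeff (m : ZMod p) k = binomSq (ZMod p) k := by
  refine prod_congr rfl fun i hi => ?_
  have hi := mem_range.1 hi
  have h1 := (invertibleUpTo_zmod hpm).succ_ne (show i < 2 * m by omega)
  have h2 := zmod_two_ne_zero hpm
  have h3 := two_mul_half_add_one hpm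
  rw [show 2 * (i : ZMod p) + 2 = 2 * (i + 1) by ring]
  field_simp
  linear_combination (-2 * (m : ZMod p) - 1) * h3

lemma legCoeff_half_eq_choose (hpm : 2 * m + 1 = p) {k : ℕ} (hk : k ≤ m) :
    legCoeff (m : ZMod p) k = (m.choose k : ZMod p) ^ 2 := by
  induction k with
  | zero => simp [legCoeff]
  | succ k ih =>
    have h1 := (invertibleUpTo_zmod hpm).succ_ne (show k < 2 * m by omega)
    have h3 := two_mul_half_add_one hpm
    have h4 : (m.choose (k + 1) : ZMod p) * (k + 1) = m.choose k * (m - k) := by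
      have := Nat.choose_succ_right_eq m k
      have h5 := congrArg (Nat.cast : ℕ → ZMod p) this
      rw [Nat.cast_mul, Nat.cast_mul, Nat.cast_sub (by omega)] at h5
      exact_mod_cast h5
    have h6 : (m.choose (k + 1) : ZMod p) = m.choose k * (m - k) / (k + 1) := by
      field_simp; exact h4
    rw [legCoeff_succ, ih (by omega), h6, div_pow, mul_pow,
      show (k : ZMod p) + 1 + m = -(m - k) by linear_combination h3]
    ring

/-- Modulo `p` the Legendre coefficients are the squares `C(m,k)^2`, hence symmetric. -/
lemma legCoeff_half_symm (hpm : 2 * m + 1 = p) {k : ℕ} (hk : k ≤ m) :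
    legCoeff (m : ZMod p) (m - k) = legCoeff (m : ZMod p) k := by
  rw [legCoeff_half_eq_choose hpm hk, legCoeff_half_eq_choose hpm (Nat.sub_le m k),
    Nat.choose_symm hk]

lemma four_mul_oddHarm_zmod (hpm : 2 * m + 1 = p) {k : ℕ} (hk : k ≤ m) :
    4 * oddHarm (ZMod p) 2 k = harm (ZMod p) 2 m - harm (ZMod p) 2 (m - k) := by
  induction k with
  | zero => simp [oddHarm]
  | succ k ih =>
    have h1 := (invertibleUpTo_zmod hpm).two_mul_succ_ne (show 2 * k < 2 * m by omega)
    have h2 := (invertibleUpTo_zmod hpm).succ_ne (show m - (k + 1) < 2 * m by omega)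
    have h3 := two_mul_half_add_one hpm
    have h5 : m - k = m - (k + 1) + 1 := by omega
    have ih := ih (by omega)
    rw [h5, harm_succ] at ih
    have h6 : (2 * (k : ZMod p) + 1) = -2 * (((m - (k + 1) : ℕ) : ZMod p) + 1) := by
      rw [Nat.cast_sub hk]; push_cast; linear_combination h3
    have h7 : (4 : ZMod p) ≠ 0 := by
      rw [show (4 : ZMod p) = 2 * 2 by norm_num]
      exact mul_ne_zero (zmod_two_ne_zero hpm) (zmod_two_ne_zero hpm)
    rw [oddHarm_succ, mul_add, ih, h6, mul_pow, show (-2 : ZMod p) ^ 2 = 4 by norm_num]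
    field_simp
    ring

/-- Reflection `k ↦ m - k` of a sum weighted by `1/(2k+1) = -1/(2(m-k))`. -/
lemma sum_legCoeff_div_odd_reflect (hpm : 2 * m + 1 = p) (Y : ℕ → ZMod p) :
    ∑ k ∈ range m, legCoeff (m : ZMod p) k * Y k / (2 * k + 1) =
      -(1 / 2) * ∑ k ∈ range m, legCoeff (m : ZMod p) (k + 1) * Y (m - (k + 1)) / (k + 1) := by
  rw [← sum_range_reflect, mul_sum]
  refine sum_congr rfl fun k hk => ?_
  have hk := mem_range.1 hk
  have h1 := (invertibleUpTo_zmod hpm).succ_ne (show k < 2 * m by omega)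
  have h2 := zmod_two_ne_zero hpm
  have h3 := two_mul_half_add_one hpm
  have h4 : m - 1 - k = m - (k + 1) := by omega
  have h5 : 2 * ((m - (k + 1) : ℕ) : ZMod p) + 1 = -2 * (k + 1) := by
    rw [Nat.cast_sub (by omega)]; push_cast; linear_combination h3
  rw [h4, legCoeff_half_symm hpm (by omega), h5]
  field_simp

lemma sum_legCoeff_oddHarm_zmod (hpm : 2 * m + 1 = p) (h0 : harm (ZMod p) 2 m = 0) :
    ∑ k ∈ range m, legCoeff (m : ZMod p) k * oddHarm (ZMod p) 2 k / (2 * k + 1) =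
      -(1 / 4) * harm (ZMod p) 3 m := by
  have h2 := zmod_two_ne_zero hpm
  have h := sum_legCoeff_harm_div ((invertibleUpTo_zmod hpm).mono (show m ≤ 2 * m by omega))
  have h4 : (4 : ZMod p) = 2 * 2 := by norm_num
  have key : ∑ k ∈ range m, legCoeff (m : ZMod p) (k + 1) *
      oddHarm (ZMod p) 2 (m - (k + 1)) / (k + 1) = -(1 / 4) *
      ∑ k ∈ range m, legCoeff (m : ZMod p) (k + 1) * harm (ZMod p) 2 (k + 1) / (k + 1) := by
    rw [mul_sum]
    refine sum_congr rfl fun k hk => ?_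
    have hk := mem_range.1 hk
    have e := four_mul_oddHarm_zmod hpm (Nat.sub_le m (k + 1))
    rw [h0, show m - (m - (k + 1)) = k + 1 by omega] at e
    have e' : oddHarm (ZMod p) 2 (m - (k + 1)) = -(1 / 4) * harm (ZMod p) 2 (k + 1) := by
      rw [h4] at e ⊢; field_simp; linear_combination e
    rw [e']
    ring
  rw [sum_legCoeff_div_odd_reflect hpm, key, h, h4]
  field_simp

lemma sum_legCoeff_harm_zmod (hpm : 2 * m + 1 = p) (h0 : harm (ZMod p) 2 m = 0) :
    ∑ k ∈ range m, legCoeff (m : ZMod p) k * harm (ZMod p) 2 k / (2 * k + 1) =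
      -4 * ∑ j ∈ range m, oddHarm (ZMod p) 1 (j + 1) / ((j : ZMod p) + 1) ^ 2 := by
  have h2 := zmod_two_ne_zero hpm
  have h := sum_legCoeff_oddHarm_div (invertibleUpTo_zmod hpm)
  have key : ∑ k ∈ range m, legCoeff (m : ZMod p) (k + 1) *
      harm (ZMod p) 2 (m - (k + 1)) / (k + 1) = -4 *
      ∑ k ∈ range m, legCoeff (m : ZMod p) (k + 1) * oddHarm (ZMod p) 2 (k + 1) / (k + 1) := by
    rw [mul_sum]
    refine sum_congr rfl fun k hk => ?_
    have hk := mem_range.1 hk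
    have e := four_mul_oddHarm_zmod hpm (show k + 1 ≤ m by omega)
    rw [h0] at e
    have e' : harm (ZMod p) 2 (m - (k + 1)) = -4 * oddHarm (ZMod p) 2 (k + 1) := by
      linear_combination e
    rw [e']
    ring
  rw [sum_legCoeff_div_odd_reflect hpm, key, h]
  field_simp

lemma sum_range_two_mul {M : Type*} [AddCommGroup M] (g : ℕ → M) (m : ℕ) :
    ∑ i ∈ range (2 * m), g i = ∑ i ∈ range m, (g i + g (2 * m - 1 - i)) := by
  rw [sum_add_distrib, two_mul, sum_range_add, add_right_inj, ← sum_range_reflect]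
  refine sum_congr rfl fun i hi => congrArg g ?_
  have := mem_range.1 hi
  omega

lemma sum_zmod_eq_sum_range (f : ZMod p → ZMod p) : ∑ y, f y = ∑ i ∈ range p, f i := by
  refine (sum_nbij' (fun i : ℕ => (i : ZMod p)) ZMod.val ?_ ?_ ?_ ?_ ?_).symm
  · simp
  · intro a _; exact mem_range.2 (ZMod.val_lt a)
  · intro a ha; exact ZMod.val_cast_of_lt (mem_range.1 ha)
  · intro a _; exact ZMod.natCast_zmod_val a
  · intro a _; rfl

/-- `sineProd y k` is an even polynomial in `y` of degree `2k < p - 1`, so its values on `ℤ/p` sum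
to zero. -/
lemma sum_sineProd_zmod (hpm : 2 * m + 1 = p) {k : ℕ} (hk : k < m) :
    ∑ n ∈ range m, sineProd (((n + 1 : ℕ) : ZMod p)) k = -(1 / 2) := by
  have h2 := zmod_two_ne_zero hpm
  let P : Polynomial (ZMod p) :=
    ∏ i ∈ range k, (1 - Polynomial.C (1 / ((i : ZMod p) + 1) ^ 2) * Polynomial.X ^ 2)
  have hP : ∀ y, P.eval y = sineProd y k := by
    intro y
    simp only [P, sineProd, Polynomial.eval_prod]
    refine prod_congr rfl fun i _ => ?_
    simp
    ring
  have hdeg : P.natDegree ≤ 2 * k := by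
    refine (Polynomial.natDegree_prod_le _ _).trans ?_
    calc _ ≤ ∑ i ∈ range k, 2 := sum_le_sum fun i _ => by compute_degree
      _ = 2 * k := by simp [mul_comm]
  have hsum : ∑ y : ZMod p, sineProd y k = 0 := by
    simp only [← hP, Polynomial.eval_eq_sum_range]
    rw [sum_comm]
    refine sum_eq_zero fun i hi => ?_
    have hi := mem_range.1 hi
    rw [← mul_sum, FiniteField.sum_pow_lt_card_sub_one, mul_zero]
    rw [ZMod.card]
    omega
  have h0 : sineProd (0 : ZMod p) k = 1 := by simp [sineProd]
  have hneg : ∀ y : ZMod p, sineProd (-y) k = sineProd y k := by intro y; simp [sineProd]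
  have hrange : range p = range (2 * m + 1) := by rw [hpm]
  rw [sum_zmod_eq_sum_range, hrange, sum_range_succ', sum_range_two_mul, Nat.cast_zero, h0]
    at hsum
  have : ∀ n ∈ range m, sineProd (((n + 1 : ℕ) : ZMod p)) k +
      sineProd (((2 * m - 1 - n + 1 : ℕ) : ZMod p)) k = 2 * sineProd (((n + 1 : ℕ) : ZMod p)) k := by
    intro n hn
    have hn := mem_range.1 hn
    have : ((2 * m - 1 - n + 1 : ℕ) : ZMod p) = -((n + 1 : ℕ) : ZMod p) := by
      rw [eq_neg_iff_add_eq_zero, ← Nat.cast_add,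
        show 2 * m - 1 - n + 1 + (n + 1) = p by omega, ZMod.natCast_self]
    rw [this, hneg]
    ring
  rw [sum_congr rfl this, ← mul_sum] at hsum
  field_simp
  linear_combination hsum

/-- The value at `y = 0` of an even polynomial in `y` of degree below `p - 1` is recovered from its
values at `y = 1, …, m`, which `sum_sineProd_div_cube_mul_binomSq` provides. -/
lemma sum_inv_cube_mul_binomSq_zmod (hpm : 2 * m + 1 = p) :
    ∑ k ∈ range m, 1 / (((k : ZMod p) + 1) ^ 3 * binomSq (ZMod p) (k + 1)) =
      -8 * ∑ j ∈ range m, oddHarm (ZMod p) 1 (j + 1) / ((j : ZMod p) + 1) ^ 2 := by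
  have h2 := zmod_two_ne_zero hpm
  have hK := invertibleUpTo_zmod hpm
  have key : ∑ j ∈ range m, oddHarm (ZMod p) 1 (j + 1) / ((j : ZMod p) + 1) ^ 2 =
      ∑ j ∈ range m, 1 / 4 * ∑ k ∈ range m, sineProd (((j + 1 : ℕ) : ZMod p)) k /
        (((k : ZMod p) + 1) ^ 3 * binomSq (ZMod p) (k + 1)) := by
    refine sum_congr rfl fun j hj => ?_
    have hj := mem_range.1 hj
    have h1 := hK.succ_ne (show j < 2 * m by omega)
    have e := sum_sineProd_div_cube_mul_binomSq (hK.mono (show 2 * (j + 1) ≤ 2 * m by omega))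
    have hext : ∑ k ∈ range (j + 1), sineProd (((j + 1 : ℕ) : ZMod p)) k /
        (((k : ZMod p) + 1) ^ 3 * binomSq (ZMod p) (k + 1)) =
        ∑ k ∈ range m, sineProd (((j + 1 : ℕ) : ZMod p)) k /
        (((k : ZMod p) + 1) ^ 3 * binomSq (ZMod p) (k + 1)) := by
      refine sum_subset (range_subset_range.2 (by omega)) fun k _ hk => ?_
      rw [sineProd_eq_zero j.succ_pos (by simpa using hk) (hK _ j.succ_pos (by omega)), zero_div]
    have h4 : (4 : ZMod p) = 2 * 2 := by norm_num
    rw [← hext]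
    push_cast at e h1 ⊢
    rw [h4] at e ⊢
    rw [div_eq_iff (pow_ne_zero 2 h1)]
    field_simp
    linear_combination -e
  have h4 : (4 : ZMod p) ≠ 0 := by
    rw [show (4 : ZMod p) = 2 * 2 by norm_num]; exact mul_ne_zero h2 h2
  rw [key, ← mul_sum, sum_comm]
  have : ∀ k ∈ range m, ∑ j ∈ range m, sineProd (((j + 1 : ℕ) : ZMod p)) k /
      (((k : ZMod p) + 1) ^ 3 * binomSq (ZMod p) (k + 1)) =
      -(1 / 2) * (1 / (((k : ZMod p) + 1) ^ 3 * binomSq (ZMod p) (k + 1))) := by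
    intro k hk
    rw [← sum_div, sum_sineProd_zmod hpm (mem_range.1 hk)]
    ring
  rw [sum_congr rfl this, ← mul_sum]
  field_simp
  ring

end ModPrime

/-! ### Reduction of `p`-integral rationals modulo `p` -/

/-- The rational number `q` is `p`-integral and its residue in `ℤ/p` is `x`. -/
structure Reduces (p : ℕ) [Fact p.Prime] (q : ℚ) (x : ZMod p) : Prop where
  not_dvd_den : ¬ p ∣ q.den
  cast_eq : (q : ZMod p) = x

namespace Reduces

variable {p : ℕ} [Fact p.Prime] {q r : ℚ} {x y : ZMod p}

lemma den_ne_zero (h : Reduces p q x) : (q.den : ZMod p) ≠ 0 := by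
  rw [Ne, ZMod.natCast_eq_zero_iff]
  exact h.not_dvd_den

lemma natCast (n : ℕ) : Reduces p n n :=
  ⟨by simpa using (Fact.out : p.Prime).ne_one, by simp⟩

lemma intCast (n : ℤ) : Reduces p n n :=
  ⟨by simpa using (Fact.out : p.Prime).ne_one, by simp⟩

lemma two : Reduces p 2 2 := by exact_mod_cast natCast (p := p) 2

lemma zero : Reduces p 0 0 := by simpa using natCast (p := p) 0

lemma one : Reduces p 1 1 := by simpa using natCast (p := p) 1

lemma self : Reduces p p 0 := by simpa using natCast (p := p) p

lemma add (hq : Reduces p q x) (hr : Reduces p r y) : Reduces p (q + r) (x + y) := by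
  refine ⟨fun h => ?_, ?_⟩
  · rcases (Fact.out : p.Prime).dvd_mul.1 (h.trans (Rat.add_den_dvd q r)) with h | h
    · exact hq.1 h
    · exact hr.1 h
  · rw [Rat.cast_add_of_ne_zero hq.den_ne_zero hr.den_ne_zero, hq.2, hr.2]

lemma mul (hq : Reduces p q x) (hr : Reduces p r y) : Reduces p (q * r) (x * y) := by
  refine ⟨fun h => ?_, ?_⟩
  · rcases (Fact.out : p.Prime).dvd_mul.1 (h.trans (Rat.mul_den_dvd q r)) with h | h
    · exact hq.1 h
    · exact hr.1 h
  · rw [Rat.cast_mul_of_ne_zero hq.den_ne_zero hr.den_ne_zero, hq.2, hr.2]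

lemma neg (hq : Reduces p q x) : Reduces p (-q) (-x) :=
  ⟨by simpa using hq.1, by rw [Rat.cast_neg, hq.2]⟩

lemma sub (hq : Reduces p q x) (hr : Reduces p r y) : Reduces p (q - r) (x - y) := by
  simpa [sub_eq_add_neg] using hq.add hr.neg

lemma pow (hq : Reduces p q x) (n : ℕ) : Reduces p (q ^ n) (x ^ n) := by
  induction n with
  | zero => simpa using one
  | succ n ih => simpa [pow_succ] using ih.mul hq

lemma inv (hq : Reduces p q x) (hx : x ≠ 0) : Reduces p q⁻¹ x⁻¹ := by
  have hnum : (q.num : ZMod p) ≠ 0 := by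
    intro h
    apply hx
    rw [← hq.2, Rat.cast_def, h, zero_div]
  refine ⟨fun h => ?_, by rw [Rat.cast_inv_of_ne_zero hnum, hq.2]⟩
  have hq0 : q ≠ 0 := by rintro rfl; simp at hnum
  rw [Rat.den_inv_of_ne_zero hq0, ← Int.natCast_dvd] at h
  exact hnum ((ZMod.intCast_zmod_eq_zero_iff_dvd _ _).2 h)

lemma div (hq : Reduces p q x) (hr : Reduces p r y) (hy : y ≠ 0) :
    Reduces p (q / r) (x / y) := by
  simpa [div_eq_mul_inv] using hq.mul (hr.inv hy)

lemma sum {s : Finset ℕ} {f : ℕ → ℚ} {g : ℕ → ZMod p} (h : ∀ i ∈ s, Reduces p (f i) (g i)) :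
    Reduces p (∑ i ∈ s, f i) (∑ i ∈ s, g i) := by
  induction s using Finset.induction_on with
  | empty => simpa using zero
  | insert a s ha ih =>
    rw [sum_insert ha, sum_insert ha]
    exact (h a (mem_insert_self a s)).add (ih fun i hi => h i (mem_insert_of_mem hi))

lemma prod {s : Finset ℕ} {f : ℕ → ℚ} {g : ℕ → ZMod p} (h : ∀ i ∈ s, Reduces p (f i) (g i)) :
    Reduces p (∏ i ∈ s, f i) (∏ i ∈ s, g i) := by
  induction s using Finset.induction_on with
  | empty => simpa using one
  | insert a s ha ih =>
    rw [prod_insert ha, prod_insert ha]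
    exact (h a (mem_insert_self a s)).mul (ih fun i hi => h i (mem_insert_of_mem hi))

lemma unique (hq : Reduces p q x) (hr : Reduces p q y) : x = y := hq.2.symm.trans hr.2

lemma self_mul (hq : Reduces p q x) : Reduces p (p * q) 0 := by simpa using self.mul hq

/-- A `p`-integral rational with zero residue is `p` times a `p`-integral rational. -/
lemma exists_eq_mul (hq : Reduces p q 0) : ∃ r y, Reduces p r y ∧ q = p * r := by
  have h := hq.2
  rw [Rat.cast_def, div_eq_zero_iff, or_iff_left hq.den_ne_zero,
    ZMod.intCast_zmod_eq_zero_iff_dvd] at h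
  obtain ⟨c, hc⟩ := h
  refine ⟨c / q.den, _, (intCast c).div (natCast q.den) hq.den_ne_zero, ?_⟩
  rw [← mul_div_assoc]
  nth_rewrite 1 [← Rat.num_div_den q]
  rw [hc]
  push_cast
  ring

end Reduces

section Reductions

variable {p m : ℕ} [Fact p.Prime]

lemma reduces_succ (k : ℕ) : Reduces p ((k : ℚ) + 1) ((k : ZMod p) + 1) :=
  (Reduces.natCast k).add .one

lemma reduces_odd (k : ℕ) : Reduces p (2 * (k : ℚ) + 1) (2 * (k : ZMod p) + 1) :=
  (Reduces.two.mul (.natCast k)).add .one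

lemma reduces_harm (hpm : 2 * m + 1 = p) (s : ℕ) {k : ℕ} (hk : k ≤ 2 * m) :
    Reduces p (harm ℚ s k) (harm (ZMod p) s k) :=
  Reduces.sum fun i hi => Reduces.one.div ((reduces_succ i).pow s) <| pow_ne_zero _ <|
    (invertibleUpTo_zmod hpm).succ_ne (by have := mem_range.1 hi; omega)

lemma reduces_oddHarm (hpm : 2 * m + 1 = p) (s : ℕ) {k : ℕ} (hk : k ≤ m) :
    Reduces p (oddHarm ℚ s k) (oddHarm (ZMod p) s k) :=
  Reduces.sum fun i hi => Reduces.one.div ((reduces_odd i).pow s) <| pow_ne_zero _ <|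
    (invertibleUpTo_zmod hpm).two_mul_succ_ne (by have := mem_range.1 hi; omega)

lemma reduces_legCoeff (hpm : 2 * m + 1 = p) {k : ℕ} (hk : k ≤ 2 * m) :
    Reduces p (legCoeff (m : ℚ) k) (legCoeff (m : ZMod p) k) :=
  Reduces.prod fun i hi => (((Reduces.natCast i).sub (.natCast m)).mul
    ((reduces_succ i).add (.natCast m))).div ((reduces_succ i).pow 2) <| pow_ne_zero _ <|
    (invertibleUpTo_zmod hpm).succ_ne (by have := mem_range.1 hi; omega)

lemma reduces_binomSq (hpm : 2 * m + 1 = p) {k : ℕ} (hk : k ≤ m) :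
    Reduces p (binomSq ℚ k) (binomSq (ZMod p) k) :=
  Reduces.prod fun i hi => ((reduces_odd i).div
    ((Reduces.two.mul (.natCast i)).add .two) (by
      have := mem_range.1 hi
      exact_mod_cast invertibleUpTo_zmod hpm (2 * i + 2) (by omega) (by omega))).pow 2

lemma reduces_sineProd (hpm : 2 * m + 1 = p) {k : ℕ} (hk : k ≤ 2 * m) :
    Reduces p (sineProd (p : ℚ) k) 1 := by
  have h : Reduces p (sineProd (p : ℚ) k) (sineProd (0 : ZMod p) k) :=
    Reduces.prod fun i hi => Reduces.one.sub <| (Reduces.self.pow 2).div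
      ((reduces_succ i).pow 2) <| pow_ne_zero _ <|
        (invertibleUpTo_zmod hpm).succ_ne (by have := mem_range.1 hi; omega)
  simpa [sineProd] using h

lemma legCoeff_half_self (hpm : 2 * m + 1 = p) : legCoeff (m : ZMod p) m = 1 := by
  rw [legCoeff_half_eq_choose hpm le_rfl]; simp

/-! ### Expansions modulo `p^4` -/

/-- `∏_{i ≤ k} (1 - p²/i²) = 1 - p² H_k^{(2)} + O(p^4)`. -/
lemma sineProd_expansion (hpm : 2 * m + 1 = p) {k : ℕ} (hk : k ≤ 2 * m) :
    ∃ r x, Reduces p r x ∧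
      sineProd (p : ℚ) k = 1 - (p : ℚ) ^ 2 * harm ℚ 2 k + (p : ℚ) ^ 4 * r := by
  induction k with
  | zero => exact ⟨0, 0, .zero, by simp [sineProd, harm]⟩
  | succ k ih =>
    obtain ⟨r, x, hr, h⟩ := ih (by omega)
    have hc : Reduces p (1 / ((k : ℚ) + 1) ^ 2) (1 / ((k : ZMod p) + 1) ^ 2) :=
      Reduces.one.div ((reduces_succ k).pow 2) (pow_ne_zero _
        ((invertibleUpTo_zmod hpm).succ_ne hk))
    refine ⟨r + harm ℚ 2 k * (1 / ((k : ℚ) + 1) ^ 2) - p ^ 2 * (r * (1 / ((k : ℚ) + 1) ^ 2)), _,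
      (hr.add ((reduces_harm hpm 2 (by omega)).mul hc)).sub ((Reduces.self.pow 2).mul (hr.mul hc)),
      ?_⟩
    rw [sineProd_succ, h, harm_succ]
    ring

/-- Comparison of `(C(2k,k)/4^k)^2` with the Legendre coefficient at `m = (p-1)/2`: their quotient
is `∏_{j ≤ k} (1 - p²/(2j-1)²)⁻¹ = 1 + p² ∑ 1/(2j-1)² + O(p^4)`. -/
lemma binomSq_expansion (hpm : 2 * m + 1 = p) {k : ℕ} (hk : k ≤ m) :
    ∃ r x, Reduces p r x ∧ binomSq ℚ k =
      legCoeff (m : ℚ) k * (1 + (p : ℚ) ^ 2 * oddHarm ℚ 2 k + (p : ℚ) ^ 4 * r) := by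
  induction k with
  | zero => exact ⟨0, 0, .zero, by simp [binomSq, oddHarm, legCoeff]⟩
  | succ k ih =>
    obtain ⟨r, x, hr, h⟩ := ih (by omega)
    have hne := (invertibleUpTo_zmod hpm).two_mul_succ_ne (show 2 * k < 2 * m by omega)
    have hc : Reduces p (1 / (2 * (k : ℚ) + 1) ^ 2) (1 / (2 * (k : ZMod p) + 1) ^ 2) :=
      Reduces.one.div ((reduces_odd k).pow 2) (pow_ne_zero _ hne)
    have hden : Reduces p ((2 * (k : ℚ) + 1) ^ 2 - (p : ℚ) ^ 2)
        ((2 * (k : ZMod p) + 1) ^ 2 - 0 ^ 2) := ((reduces_odd k).pow 2).sub (Reduces.self.pow 2)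
    have hden0 : (2 * (k : ZMod p) + 1) ^ 2 - 0 ^ 2 ≠ 0 := by
      simpa using hne
    have he : Reduces p ((2 * (k : ℚ) + 1) ^ 2 / ((2 * (k : ℚ) + 1) ^ 2 - (p : ℚ) ^ 2)) _ :=
      ((reduces_odd k).pow 2).div hden hden0
    have hO := reduces_oddHarm hpm 2 (show k ≤ m by omega)
    set c := 1 / (2 * (k : ℚ) + 1) ^ 2 with hc_def
    set e := (2 * (k : ℚ) + 1) ^ 2 / ((2 * (k : ℚ) + 1) ^ 2 - (p : ℚ) ^ 2) with he_def
    have hp2 := Reduces.pow (Reduces.self (p := p)) 2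
    refine ⟨r + oddHarm ℚ 2 k * c + c ^ 2 * e +
      p ^ 2 * (r * c + oddHarm ℚ 2 k * c ^ 2 * e) + p ^ 2 * p ^ 2 * (r * c ^ 2 * e), _,
      (((hr.add (hO.mul hc)).add ((hc.pow 2).mul he)).add
        (hp2.mul ((hr.mul hc).add ((hO.mul (hc.pow 2)).mul he)))).add
        ((hp2.mul hp2).mul ((hr.mul (hc.pow 2)).mul he)), ?_⟩
    have h1 : 2 * (k : ℚ) + 1 ≠ 0 := by positivity
    have h2 : (2 * (k : ℚ) + 1) ^ 2 - (p : ℚ) ^ 2 ≠ 0 := by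
      intro h0
      have := hden.2
      rw [h0, Rat.cast_zero] at this
      exact hden0 this.symm
    have h3 : (k : ℚ) + 1 ≠ 0 := by positivity
    have hpq : (p : ℚ) = 2 * m + 1 := by rw [← hpm]; push_cast; ring
    have hce : e = 1 + (p : ℚ) ^ 2 * c + (p : ℚ) ^ 4 * (c ^ 2 * e) := by
      rw [he_def, hc_def]
      field_simp
      ring
    have hratio : ((2 * k + 1 : ℚ) / (2 * k + 2)) ^ 2 =
        ((k : ℚ) - m) * (k + 1 + m) / (k + 1) ^ 2 * e := by
      rw [he_def, show 2 * (k : ℚ) + 2 = 2 * (k + 1) by ring]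
      field_simp
      rw [hpq]
      ring
    rw [binomSq_succ, h, hratio, legCoeff_succ, oddHarm_succ, ← hc_def]
    nth_rewrite 1 [hce]
    ring

end Reductions

/-! ### Harmonic numbers modulo `p^2` -/

section Harmonic

variable {p m : ℕ} [Fact p.Prime]

lemma harm_two_mul (s m : ℕ) :
    harm ℚ s (2 * m) = oddHarm ℚ s m + 1 / 2 ^ s * harm ℚ s m := by
  induction m with
  | zero => simp [harm, oddHarm]
  | succ m ih =>
    rw [show 2 * (m + 1) = 2 * m + 1 + 1 by ring, harm_succ, harm_succ, ih, oddHarm_succ,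
      harm_succ]
    push_cast
    rw [show 2 * (m : ℚ) + 1 + 1 = 2 * (m + 1) by ring, mul_pow]
    field_simp
    ring

lemma one_div_sub_sq {x P : ℚ} (hx : x ≠ 0) (hP : P - x ≠ 0) :
    1 / (P - x) ^ 2 =
      1 / x ^ 2 + P * (2 / x ^ 3) + P ^ 2 * ((3 * x - 2 * P) / (x ^ 3 * (P - x) ^ 2)) := by
  field_simp
  ring

lemma reduces_one_div_sub_sq_remainder {q : ℚ} {x : ZMod p} (hq : Reduces p q x) (hx : x ≠ 0) :
    ∃ y, Reduces p ((3 * q - 2 * p) / (q ^ 3 * (p - q) ^ 2)) y := by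
  have h3 : Reduces p 3 3 := by exact_mod_cast Reduces.natCast (p := p) 3
  refine ⟨_, ((h3.mul hq).sub (Reduces.two.mul .self)).div
    ((hq.pow 3).mul ((Reduces.self.sub hq).pow 2)) ?_⟩
  simpa using hx

/-- With `H_s = ∑_{i ≤ (p-1)/2} 1/i^s`, the reflection `i ↦ p - i` gives
`H_2 ≡ -(7/6) p H_3` and `∑_{odd i < p} 1/i² ≡ -(1/24) p H_3` modulo `p²`. -/
lemma harm_two_expansion (hpm : 2 * m + 1 = p) (hp : 3 < p) :
    ∃ h o : ℚ, Reduces p h (-(7 / 6) * harm (ZMod p) 3 m) ∧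
      Reduces p o (-(1 / 24) * harm (ZMod p) 3 m) ∧
      harm ℚ 2 m = p * h ∧ oddHarm ℚ 2 m = p * o := by
  have hK := invertibleUpTo_zmod hpm
  let R : ℚ → ℚ := fun x => (3 * x - 2 * p) / (x ^ 3 * (p - x) ^ 2)
  have hpq : (p : ℚ) = 2 * m + 1 := by rw [← hpm]; push_cast; ring
  have hne : ∀ i ∈ range m, (p : ℚ) - (i + 1) ≠ 0 ∧ (p : ℚ) - 2 * (i + 1) ≠ 0 := by
    intro i hi
    have hi' : (i : ℚ) + 1 ≤ m := by exact_mod_cast mem_range.1 hi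
    have : (0 : ℚ) ≤ i := Nat.cast_nonneg i
    constructor <;> rw [hpq] <;> intro h <;> linarith
  have e1 : harm ℚ 2 (2 * m) = 2 * harm ℚ 2 m + 2 * p * harm ℚ 3 m +
      p ^ 2 * ∑ i ∈ range m, R (i + 1) := by
    unfold harm
    rw [sum_range_two_mul, mul_sum, mul_sum, mul_sum, ← sum_add_distrib, ← sum_add_distrib]
    refine sum_congr rfl fun i hi => ?_
    have hi' := mem_range.1 hi
    have h1 : ((2 * m - 1 - i : ℕ) : ℚ) + 1 = p - (i + 1) := by
      rw [Nat.cast_sub (by omega), Nat.cast_sub (by omega), hpq]; push_cast; ring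
    rw [h1, one_div_sub_sq (by positivity) (hne i hi).1]
    ring
  have e2 : oddHarm ℚ 2 m = 1 / 4 * harm ℚ 2 m + 1 / 4 * p * harm ℚ 3 m +
      p ^ 2 * ∑ i ∈ range m, R (2 * (i + 1)) := by
    unfold harm oddHarm
    rw [← sum_range_reflect, mul_sum, mul_sum, mul_sum, ← sum_add_distrib, ← sum_add_distrib]
    refine sum_congr rfl fun i hi => ?_
    have hi' := mem_range.1 hi
    have h1 : 2 * ((m - 1 - i : ℕ) : ℚ) + 1 = p - 2 * (i + 1) := by
      rw [Nat.cast_sub (by omega), Nat.cast_sub (by omega), hpq]; push_cast; ring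
    rw [h1, one_div_sub_sq (by positivity) (hne i hi).2]
    have : (i : ℚ) + 1 ≠ 0 := by positivity
    change _ = _ + p ^ 2 * ((3 * (2 * ((i : ℚ) + 1)) - 2 * p) /
      ((2 * ((i : ℚ) + 1)) ^ 3 * (p - 2 * (i + 1)) ^ 2))
    congr 1
    field_simp
    ring
  have e3 := harm_two_mul 2 m
  set R1 := ∑ i ∈ range m, R (i + 1)
  set R2 := ∑ i ∈ range m, R (2 * (i + 1))
  have hR1 : ∃ y, Reduces p R1 y := by
    have : ∀ i : ℕ, ∃ y, i ∈ range m → Reduces p (R (i + 1)) y := by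
      intro i
      by_cases hi : i ∈ range m
      · obtain ⟨y, hy⟩ := reduces_one_div_sub_sq_remainder (reduces_succ (p := p) i)
          (hK.succ_ne (by have := mem_range.1 hi; omega))
        exact ⟨y, fun _ => hy⟩
      · exact ⟨0, fun h => absurd h hi⟩
    choose g hg using this
    exact ⟨_, Reduces.sum hg⟩
  have hR2 : ∃ y, Reduces p R2 y := by
    have : ∀ i : ℕ, ∃ y, i ∈ range m → Reduces p (R (2 * (i + 1))) y := by
      intro i
      by_cases hi : i ∈ range m
      · obtain ⟨y, hy⟩ := reduces_one_div_sub_sq_remainder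
          (Reduces.two.mul (reduces_succ (p := p) i))
          (mul_ne_zero (zmod_two_ne_zero hpm)
            (hK.succ_ne (by have := mem_range.1 hi; omega)))
        exact ⟨y, fun _ => hy⟩
      · exact ⟨0, fun h => absurd h hi⟩
    choose g hg using this
    exact ⟨_, Reduces.sum hg⟩
  obtain ⟨y1, hy1⟩ := hR1
  obtain ⟨y2, hy2⟩ := hR2
  have h2 : (2 : ZMod p) ≠ 0 := zmod_two_ne_zero hpm
  have h3 : (3 : ZMod p) ≠ 0 := by exact_mod_cast hK 3 (by omega) (by omega)
  have r3 : Reduces p 3 3 := by exact_mod_cast Reduces.natCast (p := p) 3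
  have r7 : Reduces p 7 7 := by exact_mod_cast Reduces.natCast (p := p) 7
  have rH := reduces_harm hpm 3 (show m ≤ 2 * m by omega)
  have rh := ((r7.div (Reduces.two.mul r3) (mul_ne_zero h2 h3)).neg.mul rH).add
    (Reduces.self.mul ((Reduces.two.div r3 h3).mul (hy2.sub hy1)))
  have r4 := Reduces.one.div (Reduces.two.mul (.two (p := p))) (mul_ne_zero h2 h2)
  have ro := (((r4.mul rh)).add (r4.mul rH)).add (Reduces.self.mul hy2)
  refine ⟨_, _, ⟨rh.1, rh.2.trans ?_⟩, ⟨ro.1, ro.2.trans ?_⟩, ?_, ?_⟩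
  · rw [show (6 : ZMod p) = 2 * 3 by norm_num]; ring
  · rw [show (24 : ZMod p) = 2 * 2 * 2 * 3 by norm_num]; field_simp; ring
  · linear_combination (2 / 3) * (e3 - e1 + e2)
  · linear_combination e2 + 1 / 4 * ((2 / 3) * (e3 - e1 + e2))

end Harmonic

/-! ### The Bernoulli number `B_{p-3}` -/

section Bernoulli

variable {p m : ℕ} [Fact p.Prime]

lemma reduces_bernoulli' {n : ℕ} (hn : n + 1 < p) : ∃ x, Reduces p (bernoulli' n) x := by
  induction n using Nat.strong_induction_on with
  | _ n ih =>
    have : ∀ k : ℕ, ∃ x : ZMod p, k ∈ range n →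
        Reduces p (n.choose k / (n - k + 1) * bernoulli' k) x := by
      intro k
      by_cases hk : k ∈ range n
      · have hk' := mem_range.1 hk
        obtain ⟨x, hx⟩ := ih k hk' (by omega)
        have hne : ((n - k + 1 : ℕ) : ZMod p) ≠ 0 := by
          rw [Ne, ZMod.natCast_eq_zero_iff]
          exact fun h => absurd (Nat.le_of_dvd (Nat.succ_pos _) h) (by omega)
        have h := ((Reduces.natCast (p := p) (n.choose k)).div
          (Reduces.natCast (n - k + 1)) hne).mul hx
        rw [show ((n - k + 1 : ℕ) : ℚ) = n - k + 1 by
          rw [Nat.cast_succ, Nat.cast_sub hk'.le]] at h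
        exact ⟨_, fun _ => h⟩
      · exact ⟨0, fun h => absurd h hk⟩
    choose g hg using this
    rw [bernoulli'_def]
    exact ⟨_, Reduces.one.sub (Reduces.sum hg)⟩

lemma reduces_bernoulli {n : ℕ} (hn : n + 1 < p) : ∃ x, Reduces p (bernoulli n) x := by
  obtain ⟨x, hx⟩ := reduces_bernoulli' hn
  exact ⟨_, (Reduces.one.neg.pow n).mul hx⟩

/-- `∑_{k<p} k^n ≡ p B_n` modulo `p²`. -/
lemma sum_pow_expansion {n : ℕ} (hn : n + 2 < p) :
    ∃ r x, Reduces p r x ∧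
      ∑ k ∈ range p, (k : ℚ) ^ n = p * bernoulli n + (p : ℚ) ^ 2 * r := by
  have hne : ((n + 1 : ℕ) : ZMod p) ≠ 0 := by
    rw [Ne, ZMod.natCast_eq_zero_iff]
    exact fun h => absurd (Nat.le_of_dvd (Nat.succ_pos _) h) (by omega)
  have : ∀ i : ℕ, ∃ x : ZMod p, i ∈ range n → Reduces p
      (bernoulli i * (n + 1).choose i * (p : ℚ) ^ (n - 1 - i) / ((n + 1 : ℕ) : ℚ)) x := by
    intro i
    by_cases hi : i ∈ range n
    · have hi' := mem_range.1 hi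
      obtain ⟨x, hx⟩ := reduces_bernoulli (p := p) (show i + 1 < p by omega)
      exact ⟨_, fun _ => ((hx.mul (.natCast _)).mul (Reduces.self.pow _)).div (.natCast _) hne⟩
    · exact ⟨0, fun h => absurd h hi⟩
  choose g hg using this
  refine ⟨_, _, Reduces.sum hg, ?_⟩
  rw [sum_range_pow, sum_range_succ, add_comm, mul_sum]
  congr 1
  · rw [show n + 1 - n = 1 by omega, Nat.choose_succ_self_right]
    push_cast
    field_simp
  · refine sum_congr rfl fun i hi => ?_
    have hi' := mem_range.1 hi
    rw [show n + 1 - i = n - 1 - i + 2 by omega, pow_add]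
    push_cast
    ring

lemma exists_sub_pow_succ (x P : ℤ) (n : ℕ) :
    ∃ z, (x - P) ^ (n + 1) = x ^ (n + 1) - (n + 1) * P * x ^ n + P ^ 2 * z := by
  induction n with
  | zero => exact ⟨0, by simp⟩
  | succ n ih =>
    obtain ⟨z, hz⟩ := ih
    refine ⟨(n + 1) * x ^ n + z * (x - P), ?_⟩
    rw [pow_succ, hz]
    push_cast
    ring

/-- Splitting `∑_{k<p} k^n` with `n = p - 3` by reflection and by parity, and comparing both with
`p B_n` modulo `p²`. -/
lemma reduces_bernoulli_sub_three (hpm : 2 * m + 1 = p) (hp : 3 < p) :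
    ∃ B, Reduces p (bernoulli (p - 3)) B ∧ harm (ZMod p) 3 m = -2 * B := by
  obtain ⟨N, hN⟩ : ∃ N, p = N + 4 := ⟨p - 4, by omega⟩
  have hn : p - 3 = N + 1 := by omega
  rw [hn]
  have heven : Even (N + 1) := ⟨m - 1, by omega⟩
  obtain ⟨B, hB⟩ := reduces_bernoulli (p := p) (show N + 1 + 1 < p by omega)
  obtain ⟨r, x, hr, hs⟩ := sum_pow_expansion (p := p) (show N + 1 + 2 < p by omega)
  refine ⟨B, hB, ?_⟩
  have hK := invertibleUpTo_zmod hpm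
  choose z hz using fun x : ℤ => exists_sub_pow_succ x (p : ℤ) N
  have hrefl : ∀ x : ℤ, ((p : ℤ) - x) ^ (N + 1) =
      x ^ (N + 1) - (N + 1) * p * x ^ N + (p : ℤ) ^ 2 * z x := by
    intro x
    rw [← hz, ← heven.neg_pow, neg_sub]
  have hpz : (p : ℤ) = 2 * m + 1 := by rw [← hpm]; push_cast; ring
  set S : ℤ := ∑ k ∈ range p, (k : ℤ) ^ (N + 1)
  set σ : ℤ := ∑ i ∈ range m, ((i : ℤ) + 1) ^ (N + 1)
  set τ : ℤ := ∑ i ∈ range m, ((i : ℤ) + 1) ^ N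
  set z1 : ℤ := ∑ i ∈ range m, z (i + 1)
  set z2 : ℤ := ∑ i ∈ range m, z (2 * (i + 1))
  have hS : S = ∑ k ∈ range (2 * m), ((k : ℤ) + 1) ^ (N + 1) := by
    simp only [S]
    rw [show range p = range (2 * m + 1) by rw [hpm], sum_range_succ']
    simp
  have e1 : S = 2 * σ - (N + 1) * p * τ + (p : ℤ) ^ 2 * z1 := by
    rw [hS, sum_range_two_mul]
    simp only [σ, τ, z1, mul_sum]
    rw [← sum_sub_distrib, ← sum_add_distrib]
    refine sum_congr rfl fun i hi => ?_
    have hi' := mem_range.1 hi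
    have h1 : ((2 * m - 1 - i : ℕ) : ℤ) + 1 = p - (i + 1) := by
      rw [hpz]; omega
    rw [h1, hrefl]
    ring
  have e2 : S = 2 ^ (N + 1) * (2 * σ) - (N + 1) * p * 2 ^ N * τ + (p : ℤ) ^ 2 * z2 := by
    have hsplit : ∀ l : ℕ, ∑ k ∈ range (2 * l), ((k : ℤ) + 1) ^ (N + 1) =
        ∑ i ∈ range l, (2 * (i : ℤ) + 1) ^ (N + 1) +
        ∑ i ∈ range l, (2 * ((i : ℤ) + 1)) ^ (N + 1) := by
      intro l
      induction l with
      | zero => simp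
      | succ l ih =>
        rw [show 2 * (l + 1) = 2 * l + 1 + 1 by ring, sum_range_succ, sum_range_succ, ih,
          sum_range_succ _ l, sum_range_succ _ l]
        push_cast
        ring
    rw [hS, hsplit, ← sum_range_reflect]
    simp only [σ, τ, z2, mul_sum]
    rw [← sum_add_distrib, ← sum_sub_distrib, ← sum_add_distrib]
    refine sum_congr rfl fun i hi => ?_
    have hi' := mem_range.1 hi
    have h1 : 2 * ((m - 1 - i : ℕ) : ℤ) + 1 = p - 2 * (i + 1) := by
      rw [hpz]; omega
    rw [h1, hrefl, mul_pow, mul_pow]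
    ring
  have e3 : ((2 : ℤ) ^ (N + 1) - 1) * S =
      -(N + 1) * p * 2 ^ N * τ + (p : ℤ) ^ 2 * (2 ^ (N + 1) * z1 - z2) := by
    linear_combination 2 ^ (N + 1) * e1 - e2
  have hSq : ((S : ℤ) : ℚ) = p * bernoulli (N + 1) + (p : ℚ) ^ 2 * r := by
    rw [← hs]; simp only [S]; push_cast; rfl
  have hp0 : (p : ℚ) ≠ 0 := by exact_mod_cast (Fact.out : p.Prime).ne_zero
  have e4 : ((2 : ℚ) ^ (N + 1) - 1) * (bernoulli (N + 1) + p * r) =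
      -(N + 1) * 2 ^ N * τ + p * (2 ^ (N + 1) * z1 - z2) := by
    have h := congrArg (Int.cast : ℤ → ℚ) e3
    push_cast at h
    rw [hSq] at h
    apply mul_left_cancel₀ hp0
    linear_combination h
  have hleft : Reduces p (((2 : ℚ) ^ (N + 1) - 1) * (bernoulli (N + 1) + p * r))
      (((2 : ZMod p) ^ (N + 1) - 1) * (B + 0 * x)) :=
    ((Reduces.two.pow _).sub .one).mul (hB.add (Reduces.self.mul hr))
  have hright : Reduces p (-((N : ℚ) + 1) * 2 ^ N * τ + p * (2 ^ (N + 1) * z1 - z2))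
      (-((N : ZMod p) + 1) * 2 ^ N * τ + 0 * (2 ^ (N + 1) * z1 - z2)) :=
    (((reduces_succ N).neg.mul (Reduces.two.pow N)).mul (.intCast τ)).add
      (Reduces.self.mul (((Reduces.two.pow _).mul (.intCast z1)).sub (.intCast z2)))
  rw [e4] at hleft
  have e5 := hleft.unique hright
  have hτ : (τ : ZMod p) = harm (ZMod p) 3 m := by
    simp only [τ, harm]
    push_cast
    refine sum_congr rfl fun i hi => ?_
    have h1 := hK.succ_ne (show i < 2 * m by have := mem_range.1 hi; omega)
    have hf := ZMod.pow_card_sub_one_eq_one h1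
    rw [show p - 1 = N + 3 by omega, pow_add] at hf
    field_simp
    linear_combination hf
  have hN4 : (N : ZMod p) = -4 := by
    have : ((N + 4 : ℕ) : ZMod p) = 0 := by rw [← hN]; exact ZMod.natCast_self p
    push_cast at this
    linear_combination this
  have h2 : (2 : ZMod p) ≠ 0 := zmod_two_ne_zero hpm
  have h3 : (3 : ZMod p) ≠ 0 := by exact_mod_cast hK 3 (by omega) (by omega)
  have hf2 := ZMod.pow_card_sub_one_eq_one h2
  rw [show p - 1 = N + 3 by omega, pow_add] at hf2
  rw [hτ, hN4, pow_succ] at e5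
  apply mul_left_cancel₀ h3
  linear_combination (-8 : ZMod p) * e5 + (2 * B - 3 * harm (ZMod p) 3 m) * hf2

end Bernoulli

/-! ### The two halves of the sum -/

section Halves

variable {p m : ℕ}

/-- The terms `k ≤ (p-1)/2` of `p ∑ a_k ∏_{i≤k} (1 - p²/i²) / (2k+1)`, up to `p^4`. -/
lemma lower_half [Fact p.Prime] (hpm : 2 * m + 1 = p) :
    ∃ r x, Reduces p r x ∧
      p * ∑ k ∈ range (m + 1), binomSq ℚ k * sineProd (p : ℚ) k / (2 * k + 1) =
        1 + (p : ℚ) ^ 2 * (legCoeff (m : ℚ) m * oddHarm ℚ 2 m +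
          p * ∑ k ∈ range m, legCoeff (m : ℚ) k * oddHarm ℚ 2 k / (2 * k + 1) +
          2 * harm ℚ 2 m) + (p : ℚ) ^ 4 * r := by
  have hK := invertibleUpTo_zmod hpm
  have hKQ : InvertibleUpTo ℚ (2 * m + 1) := invertibleUpTo_of_charZero _
  have hpq : (p : ℚ) = 2 * m + 1 := by rw [← hpm]; push_cast; ring
  have hterm : ∀ k : ℕ, ∃ (r : ℚ) (x : ZMod p), k ≤ m → Reduces p r x ∧
      binomSq ℚ k * sineProd (p : ℚ) k = legCoeff (m : ℚ) k *
        (1 + (p : ℚ) ^ 2 * (oddHarm ℚ 2 k - harm ℚ 2 k)) + (p : ℚ) ^ 4 * r := by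
    intro k
    by_cases hk : k ≤ m
    · obtain ⟨r, x, hr, h1⟩ := binomSq_expansion hpm hk
      obtain ⟨s, y, hs, h2⟩ := sineProd_expansion hpm (show k ≤ 2 * m by omega)
      have hO := reduces_oddHarm hpm 2 hk
      have hH := reduces_harm hpm 2 (show k ≤ 2 * m by omega)
      have hL := reduces_legCoeff hpm (show k ≤ 2 * m by omega)
      have hp2 := Reduces.pow (Reduces.self (p := p)) 2
      refine ⟨legCoeff (m : ℚ) k * (s + r - oddHarm ℚ 2 k * harm ℚ 2 k +
        p ^ 2 * (oddHarm ℚ 2 k * s - r * harm ℚ 2 k) + p ^ 2 * p ^ 2 * (r * s)), _,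
        fun _ => ⟨hL.mul ((((hs.add hr).sub (hO.mul hH)).add
          (hp2.mul ((hO.mul hs).sub (hr.mul hH)))).add ((hp2.mul hp2).mul (hr.mul hs))), ?_⟩⟩
      rw [h1, h2]
      ring
    · exact ⟨0, 0, fun h => absurd h hk⟩
  choose r x hrx using hterm
  have hR : ∃ y, Reduces p (r m + p * ∑ k ∈ range m, r k / (2 * k + 1)) y :=
    ⟨_, (hrx m le_rfl).1.add (Reduces.self.mul (Reduces.sum fun k hk =>
      (hrx k (mem_range.1 hk).le).1.div (reduces_odd k)
        (hK.two_mul_succ_ne (by have := mem_range.1 hk; omega))))⟩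
  obtain ⟨y, hy⟩ := hR
  refine ⟨_, y, hy, ?_⟩
  have hpm0 : (2 * (m : ℚ) + 1) ≠ 0 := by positivity
  have e1 := sum_legCoeff_div_odd hKQ
  have e2 := sum_legCoeff_harm_div_odd hKQ
  have e3 : ∑ k ∈ range (m + 1), binomSq ℚ k * sineProd (p : ℚ) k / (2 * k + 1) =
      ∑ k ∈ range (m + 1), legCoeff (m : ℚ) k / (2 * k + 1) +
      (p : ℚ) ^ 2 * (∑ k ∈ range (m + 1), legCoeff (m : ℚ) k * oddHarm ℚ 2 k / (2 * k + 1) -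
        ∑ k ∈ range (m + 1), legCoeff (m : ℚ) k * harm ℚ 2 k / (2 * k + 1)) +
      (p : ℚ) ^ 4 * ∑ k ∈ range (m + 1), r k / (2 * k + 1) := by
    rw [← sum_sub_distrib, mul_sum, mul_sum, ← sum_add_distrib, ← sum_add_distrib]
    refine sum_congr rfl fun k hk => ?_
    rw [(hrx k (Nat.lt_succ_iff.1 (mem_range.1 hk))).2]
    ring
  rw [e3, sum_range_succ (fun k => legCoeff (m : ℚ) k * oddHarm ℚ 2 k / (2 * k + 1)),
    sum_range_succ (fun k => r k / (2 * k + 1))]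
  rw [← hpq] at e1 e2 hpm0 ⊢
  field_simp
  linear_combination e1 - (p : ℚ) ^ 2 * e2

/-- Over `ℚ` the harmonic-weighted sum is evaluated exactly, with the pole at `k = (p-1)/2`
separated off. -/
lemma sum_legCoeff_harm_half (hpm : 2 * m + 1 = p) :
    p * ∑ k ∈ range m, legCoeff (m : ℚ) k * harm ℚ 2 k / (2 * k + 1) =
      -(2 + legCoeff (m : ℚ) m) * harm ℚ 2 m := by
  have hKQ : InvertibleUpTo ℚ (2 * m + 1) := invertibleUpTo_of_charZero _
  have hpq : (p : ℚ) = 2 * m + 1 := by rw [← hpm]; push_cast; ring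
  have hpm0 : (2 * (m : ℚ) + 1) ≠ 0 := by positivity
  have e := sum_legCoeff_harm_div_odd hKQ
  rw [sum_range_succ, mul_add] at e
  rw [hpq]
  field_simp at e ⊢
  linear_combination e

/-- For `k = (p+1)/2 + l` the number `(C(2k,k)/4^k)^2` is `p²` times this `p`-unit. -/
def upperUnit (p m l : ℕ) : ℚ :=
  binomSq ℚ m * (1 / (p + 1)) ^ 2 *
    ∏ i ∈ range l, (((p : ℚ) + (2 * (i : ℚ) + 2)) / (p + (2 * i + 3))) ^ 2

lemma binomSq_upper (hpm : 2 * m + 1 = p) (l : ℕ) :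
    binomSq ℚ (m + 1 + l) = (p : ℚ) ^ 2 * upperUnit p m l := by
  have hpq : (p : ℚ) = 2 * m + 1 := by rw [← hpm]; push_cast; ring
  induction l with
  | zero =>
    have h1 : (p : ℚ) + 1 = 2 * m + 2 := by rw [hpq]; ring
    have h2 : 2 * (m : ℚ) + 2 ≠ 0 := by positivity
    rw [add_zero, binomSq_succ, upperUnit, h1, ← hpq, range_zero, prod_empty]
    field_simp
  | succ l ih =>
    have h1 : 2 * ((m + 1 + l : ℕ) : ℚ) + 1 = p + (2 * l + 2) := by rw [hpq]; push_cast; ring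
    have h2 : 2 * ((m + 1 + l : ℕ) : ℚ) + 2 = p + (2 * l + 3) := by rw [hpq]; push_cast; ring
    rw [← add_assoc, binomSq_succ, ih, h1, h2, upperUnit, upperUnit, prod_range_succ]
    ring

lemma reduces_upperUnit [Fact p.Prime] (hpm : 2 * m + 1 = p) {l : ℕ} (hl : l < m) :
    Reduces p (upperUnit p m l) (1 / ((2 * l + 1) ^ 2 * binomSq (ZMod p) l)) := by
  have hK := invertibleUpTo_zmod hpm
  have hodd : ∀ i < l, 2 * (i : ZMod p) + 3 ≠ 0 := fun i hi => by
    exact_mod_cast hK (2 * i + 3) (by omega) (by omega)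
  have h1 : Reduces p (binomSq ℚ m) 1 := by
    have := reduces_binomSq hpm le_rfl
    rwa [← legCoeff_half_eq_binomSq hpm le_rfl, legCoeff_half_self hpm] at this
  have h2 : Reduces p (1 / ((p : ℚ) + 1)) (1 / (0 + 1)) :=
    Reduces.one.div (Reduces.self.add .one) (by simp)
  have r3 : Reduces p 3 3 := by exact_mod_cast Reduces.natCast (p := p) 3
  have h3 : Reduces p (upperUnit p m l) (1 * (1 / (0 + 1)) ^ 2 *
      ∏ i ∈ range l, ((0 + (2 * (i : ZMod p) + 2)) / (0 + (2 * i + 3))) ^ 2) :=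
    (h1.mul (h2.pow 2)).mul <| Reduces.prod fun i hi =>
      ((Reduces.self.add ((Reduces.two.mul (.natCast i)).add .two)).div
        (Reduces.self.add ((Reduces.two.mul (.natCast i)).add r3))
        (by simpa using hodd i (mem_range.1 hi))).pow 2
  convert h3 using 1
  simp only [zero_add, div_one, one_pow, one_mul]
  clear h3
  induction l with
  | zero => simp [binomSq]
  | succ l ih =>
    have a1 := hK.two_mul_succ_ne (show 2 * l < 2 * m by omega)
    have a2 : 2 * (l : ZMod p) + 2 ≠ 0 := by
      exact_mod_cast hK (2 * l + 2) (by omega) (by omega)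
    have a3 := hodd l l.lt_succ_self
    have a4 : binomSq (ZMod p) l ≠ 0 := binomSq_ne_zero (hK.mono (by omega))
    rw [prod_range_succ, ← ih (by omega) fun i hi => hodd i (by omega), binomSq_succ]
    push_cast
    rw [show 2 * ((l : ZMod p) + 1) + 1 = 2 * l + 3 by ring]
    field_simp

/-- The terms `(p+1)/2 ≤ k < p` are `p³` times a sum of inverse squared binomial coefficients. -/
lemma upper_half [Fact p.Prime] (hpm : 2 * m + 1 = p) :
    ∃ t : ℚ, Reduces p t (1 / 8 * ∑ k ∈ range m,
        1 / (((k : ZMod p) + 1) ^ 3 * binomSq (ZMod p) (k + 1))) ∧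
      p * ∑ l ∈ range m, binomSq ℚ (m + 1 + l) * sineProd (p : ℚ) (m + 1 + l) /
        (2 * ((m + 1 + l : ℕ) : ℚ) + 1) = (p : ℚ) ^ 3 * t := by
  have hK := invertibleUpTo_zmod hpm
  have hpq : (p : ℚ) = 2 * m + 1 := by rw [← hpm]; push_cast; ring
  have ht : Reduces p (∑ l ∈ range m, upperUnit p m l * sineProd (p : ℚ) (m + 1 + l) /
      (p + 2 * (l + 1))) (∑ l ∈ range m,
        1 / ((2 * l + 1) ^ 2 * binomSq (ZMod p) l) * 1 / (0 + 2 * ((l : ZMod p) + 1))) := by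
    refine Reduces.sum fun l hl => ?_
    have hl := mem_range.1 hl
    refine ((reduces_upperUnit hpm hl).mul (reduces_sineProd hpm (by omega))).div
      (Reduces.self.add (Reduces.two.mul (reduces_succ l))) ?_
    rw [zero_add]
    exact mul_ne_zero (zmod_two_ne_zero hpm) (hK.succ_ne (by omega))
  refine ⟨_, ⟨ht.1, ht.2.trans ?_⟩, ?_⟩
  · rw [mul_sum]
    refine sum_congr rfl fun l hl => ?_
    have hl := mem_range.1 hl
    have a1 := hK.two_mul_succ_ne (show 2 * l < 2 * m by omega)
    have a2 := hK.succ_ne (show l < 2 * m by omega)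
    have a3 := zmod_two_ne_zero hpm
    have a4 : binomSq (ZMod p) l ≠ 0 := binomSq_ne_zero (hK.mono (by omega))
    rw [binomSq_succ, show 2 * (l : ZMod p) + 2 = 2 * (l + 1) by ring,
      show (8 : ZMod p) = 2 * 2 * 2 by norm_num, zero_add]
    field_simp
  · rw [mul_sum, mul_sum]
    refine sum_congr rfl fun l _ => ?_
    have h1 : 2 * ((m + 1 + l : ℕ) : ℚ) + 1 = p + 2 * (l + 1) := by rw [hpq]; push_cast; ring
    rw [binomSq_upper hpm, h1]
    ring

end Halves

lemma ratModEq_of_reduces {p : ℕ} [Fact p.Prime] {a b c r : ℚ} {x : ZMod p}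
    (hc : Reduces p c 0) (hr : Reduces p r x)
    (h : a - b = (p : ℚ) ^ 3 * c + (p : ℚ) ^ 4 * r) : RatModEq p 4 a b := by
  obtain ⟨d, y, hd, rfl⟩ := hc.exists_eq_mul
  exact ⟨d + r, (hd.add hr).1, by rw [h]; ring⟩

lemma sum_Icc_aperyV {p : ℕ} (hp : 0 < p) :
    ∑ n ∈ Icc 1 (p - 1), (aperyV n : ℚ) / (16 : ℚ) ^ n = ∑ n ∈ range p, normV n - 1 := by
  have h : Icc 1 (p - 1) = Ico 1 p := by
    ext n; simp only [mem_Icc, mem_Ico]; omega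
  rw [h, sum_congr rfl fun n _ => aperyV_div n, range_eq_Ico, sum_eq_sum_Ico_succ_bot hp,
    normV_zero]
  ring

lemma ratModEq_of_three_lt {p : ℕ} [Fact p.Prime] (hodd : Odd p) (hp : 3 < p) :
    RatModEq p 4 (∑ n ∈ Icc 1 (p - 1), (aperyV n : ℚ) / (16 : ℚ) ^ n)
      ((7 / 2 : ℚ) * (p : ℚ) ^ 3 * bernoulli (p - 3)) := by
  obtain ⟨m, hm⟩ := hodd
  have hpm : 2 * m + 1 = p := hm.symm
  have hK := invertibleUpTo_zmod hpm
  have hp0 : (p : ℚ) ≠ 0 := by exact_mod_cast (Fact.out : p.Prime).ne_zero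
  obtain ⟨h, o, hh, ho, e_h, e_o⟩ := harm_two_expansion hpm hp
  obtain ⟨B, hB, e_B⟩ := reduces_bernoulli_sub_three hpm hp
  obtain ⟨r, x, hr, e_low⟩ := lower_half hpm
  obtain ⟨t, ht, e_up⟩ := upper_half hpm
  have hL := reduces_legCoeff hpm (show m ≤ 2 * m by omega)
  rw [legCoeff_half_self hpm] at hL
  -- the two Legendre sums over `k < m` have no pole at `p`
  have hX : Reduces p (∑ k ∈ range m, legCoeff (m : ℚ) k * oddHarm ℚ 2 k / (2 * k + 1)) _ :=
    Reduces.sum fun k hk => ((reduces_legCoeff hpm (by have := mem_range.1 hk; omega)).mul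
      (reduces_oddHarm hpm 2 (mem_range.1 hk).le)).div (reduces_odd k)
      (hK.two_mul_succ_ne (by have := mem_range.1 hk; omega))
  have hY : Reduces p (∑ k ∈ range m, legCoeff (m : ℚ) k * harm ℚ 2 k / (2 * k + 1)) _ :=
    Reduces.sum fun k hk => ((reduces_legCoeff hpm (by have := mem_range.1 hk; omega)).mul
      (reduces_harm hpm 2 (by have := mem_range.1 hk; omega))).div (reduces_odd k)
      (hK.two_mul_succ_ne (by have := mem_range.1 hk; omega))
  have hH0 : harm (ZMod p) 2 m = 0 := by
    have := reduces_harm hpm 2 (show m ≤ 2 * m by omega)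
    rw [e_h] at this
    exact this.unique hh.self_mul
  rw [sum_legCoeff_oddHarm_zmod hpm hH0] at hX
  rw [sum_legCoeff_harm_zmod hpm hH0] at hY
  rw [sum_inv_cube_mul_binomSq_zmod hpm] at ht
  have e_Y : ∑ k ∈ range m, legCoeff (m : ℚ) k * harm ℚ 2 k / (2 * k + 1) =
      -(2 + legCoeff (m : ℚ) m) * h := by
    have := sum_legCoeff_harm_half hpm
    rw [e_h] at this
    apply mul_left_cancel₀ hp0
    linear_combination this
  rw [e_Y] at hY
  have e_W := hY.unique ((Reduces.two.add hL).neg.mul hh)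
  set W := ∑ j ∈ range m, oddHarm (ZMod p) 1 (j + 1) / ((j : ZMod p) + 1) ^ 2
  set H := harm (ZMod p) 3 m
  have h2 : (2 : ZMod p) ≠ 0 := zmod_two_ne_zero hpm
  have h3 : (3 : ZMod p) ≠ 0 := by exact_mod_cast hK 3 (by omega) (by omega)
  have r7 : Reduces p 7 7 := by exact_mod_cast Reduces.natCast (p := p) 7
  have htot := ((((hL.mul ho).add hX).add (Reduces.two.mul hh)).add ht).sub
    ((r7.div .two h2).mul hB)
  refine ratModEq_of_reduces (c := legCoeff (m : ℚ) m * o +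
    ∑ k ∈ range m, legCoeff (m : ℚ) k * oddHarm ℚ 2 k / (2 * k + 1) + 2 * h + t -
      7 / 2 * bernoulli (p - 3)) ⟨htot.1, htot.2.trans ?_⟩ hr ?_
  · have hW : W = -(7 / (2 * 2 * 2)) * H := by
      rw [show (7 : ZMod p) / 6 = 7 / (2 * 3) by norm_num] at e_W
      field_simp at e_W
      have h4 : 3 * (W * (2 * 2 * 2) + 7 * H) = 0 := by linear_combination -e_W
      have h5 := (mul_eq_zero.1 h4).resolve_left h3
      field_simp
      linear_combination h5
    rw [hW, e_B, show (24 : ZMod p) = 2 * 2 * 2 * 3 by norm_num,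
      show (6 : ZMod p) = 2 * 3 by norm_num, show (8 : ZMod p) = 2 * 2 * 2 by norm_num,
      show (4 : ZMod p) = 2 * 2 by norm_num]
    field_simp
    ring
  · have hsplit : ∑ k ∈ range p, binomSq ℚ k * sineProd (p : ℚ) k / (2 * k + 1) =
        ∑ k ∈ range (m + 1), binomSq ℚ k * sineProd (p : ℚ) k / (2 * k + 1) +
        ∑ l ∈ range m, binomSq ℚ (m + 1 + l) * sineProd (p : ℚ) (m + 1 + l) /
          (2 * ((m + 1 + l : ℕ) : ℚ) + 1) := by
      rw [← sum_range_add (fun k : ℕ => binomSq ℚ k * sineProd (p : ℚ) k / (2 * k + 1)),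
        show m + 1 + m = p by omega]
    rw [sum_Icc_aperyV (by omega), sum_normV, hsplit, mul_add, e_low, e_up, e_o, e_h]
    ring

theorem theorem3p6 (p : ℕ) (hp : p.Prime) (hodd : Odd p) :
    RatModEq p 4 (∑ n ∈ Finset.Icc 1 (p - 1), (aperyV n : ℚ) / (16 : ℚ) ^ n)
      ((7 / 2 : ℚ) * (p : ℚ) ^ 3 * bernoulli (p - 3)) := by
  have := Fact.mk hp
  rcases lt_or_ge 3 p with h | h
  · exact ratModEq_of_three_lt hodd h
  · obtain rfl : p = 3 := by
      have := hp.two_le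
      obtain ⟨k, hk⟩ := hodd
      omega
    -- the difference of the two sides is `27/32 - 189/2 = -81 * (37/32)`
    have h1 : ((-37 / 32 : ℚ)).den = 32 := by norm_num
    refine ⟨-37 / 32, by rw [h1]; norm_num, ?_⟩
    rw [sum_Icc_aperyV (by norm_num)]
    have h2 := normV_rec 0
    simp only [sum_range_succ, sum_range_zero, normV_zero, normV_one, zero_add] at h2 ⊢
    norm_num at h2 ⊢
    linarith
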